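/- **Conventions.** A partition is a finite weakly decreasing sequence $\lambda=(\lambda_1\ge\dots\ge\lambda_\ell>0)$, $\ell=\ell(\lambda)$; ${\sf np}(\lambda)$ is the number of distinct parts of $\lambda$, and $\lambda$ is a rectangle if ${\sf np}(\lambda)=1$. A skew partition $\lambda/\mu$ is a pair of partitions with $\mu\subseteq\lambda$; its diagram consists of the boxes $(i,j)$ with $1\le i\le\ell(\lambda)$ and $\mu_i<j\le\lambda_i$ (where $\mu_i=0$ for $i>\ell(\mu)$), its rows are numbered $1,\dots,\ell(\lambda)$ and its columns $1,\dots,\lambda_1$ (no columns if $\lambda=\emptyset$). Let ${\sf CS}_k(\lambda/\mu)$ be the number of boxes in column $k$. The skew Schur polynomial $s_{\lambda/\mu}(x_1,\dots,x_n)=\sum_T x^{T}$ is the sum over the semistandard fillings $T$ of the diagram with entries in $\{1,\dots,n\}$ (rows weakly increasing, columns strictly increasing), and $s_\nu=s_{\nu/\emptyset}$. It is multiplicity-free if all coefficients $c_\nu$ in its expansion $s_{\lambda/\mu}(x_1,\dots,x_n)=\sum_{\ell(\nu)\le n}c_\nu\,s_\nu(x_1,\dots,x_n)$ lie in $\{0,1\}$.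 **Properties and demolitions.** * $\lambda/\mu$ is *basic* if its diagram has no empty row and no empty column; $(\lambda/\mu)^{\sf ba}$ arises from $\lambda/\mu$ by deleting all empty rows and columns. * $\lambda/\mu$ is *$n$-sharp* if ${\sf CS}_k(\lambda/\mu)<n$ for all $1\le k\le\lambda_1$; $(\lambda/\mu)^{n\sharp}$ is $\emptyset/\emptyset$ if some ${\sf CS}_k(\lambda/\mu)>n$, and otherwise arises by deleting all columns $k$ with ${\sf CS}_k(\lambda/\mu)=n$. * If $\mu=\emptyset$ or $\lambda$ is a rectangle, put $\tau(\lambda/\mu)=\sigma(\lambda/\mu)=0$. Otherwise, with $l_1$ the multiplicity of the part $\lambda_1$ in $\lambda$, put $\tau(\lambda/\mu)=l_1-\min(l_1,\ell(\mu))$ and $\sigma(\lambda/\mu)=\lambda_{\ell(\lambda)}-\min(\mu_1,\lambda_{\ell(\lambda)})$. A basic $\lambda/\mu$ is *tight* if $\tau(\lambda/\mu)=\sigma(\lambda/\mu)=0$; $(\lambda/\mu)^{\sf ti}=(\tilde\lambda/\mu)^{\sf ba}$, where $\tilde\lambda$ arises from $\lambda$ by omitting $\tau(\lambda/\mu)$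 copies of the part $\lambda_1$ and subtracting $\sigma(\lambda/\mu)$ from every remaining part. * A basic $\lambda/\mu$ is *ordinary* if ${\sf np}(\lambda)-1\le{\sf np}(\mu)$ or $\mu=\emptyset$; $(\lambda/\mu)^{\sf or}$ is $\mu^\vee/\lambda^\vee$ if ${\sf np}(\lambda)-1>{\sf np}(\mu)$ and $\mu\ne\emptyset$, and $\lambda/\mu$ otherwise. Here $\alpha^\vee=(\lambda_1-\alpha_{\ell(\lambda)},\dots,\lambda_1-\alpha_1)$ with trailing zeros removed. **Theorem.** Let $n\ge0$, let $\lambda/\mu$ be a skew partition, and put $$D=((((\lambda/\mu)^{n\sharp})^{\sf ba})^{\sf ti})^{\sf or},\qquad \tau=\tau\bigl(((\lambda/\mu)^{n\sharp})^{\sf ba}\bigr),\qquad n'=n-\tau .$$ Then $n'\ge0$, and $D$ is basic, $n$-sharp (even $n'$-sharp, so that the polynomial $s_D(x_1,\dots,x_{n'})$ is sharp for its own number of variables), tight and ordinary. Moreover, $s_{\lambda/\mu}(x_1,\dots,x_n)$ is multiplicity-free if and only if $s_D(x_1,\dots,x_{n'})$ is multiplicity-free. -/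

import Mathlib

namespace SkewSchur

/-! Partitions are Mathlib's Young diagrams.  Rows and columns are numbered from `0`; `rowLen i` is
the part in row `i`, and `colLen 0` is the number of (nonzero) parts. -/

/-- The length of a partition, its number of nonzero parts. -/
def len (lam : YoungDiagram) : ℕ := lam.colLen 0

/-- The largest part (`0` for the empty partition). -/
def firstPart (lam : YoungDiagram) : ℕ := lam.rowLen 0

/-- The smallest nonzero part (`0` for the empty partition). -/
def lastPart (lam : YoungDiagram) : ℕ := lam.rowLen (len lam - 1)

/-- The multiplicity of the largest part (`0` for the empty partition). -/
def firstMult (lam : YoungDiagram) : ℕ := lam.rowLens.count (firstPart lam)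

/-- The number of distinct nonzero parts. -/
def np (lam : YoungDiagram) : ℕ := lam.rowLens.toFinset.card

/-- A rectangle is a partition with exactly one distinct part. -/
def IsRectangle (lam : YoungDiagram) : Prop := np lam = 1

/-- A skew partition: two partitions, one contained in the other. -/
@[ext]
structure SkewPartition where
  outer : YoungDiagram
  inner : YoungDiagram
  le : inner ≤ outer

/-- The skew partition `lam / ∅`. -/
def straight (lam : YoungDiagram) : SkewPartition := ⟨lam, ⊥, bot_le⟩

/-- The skew diagram: the boxes of the outer partition that are not in the inner one. -/
def boxes (S : SkewPartition) : Finset (ℕ × ℕ) := S.outer.cells \ S.inner.cells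

/-! ### Skew Schur polynomials -/

/-- Semistandard fillings with `n` symbols: rows weakly increase from left to right, columns
strictly increase from top to bottom. -/
def IsSemistandard (S : SkewPartition) {n : ℕ} (T : boxes S → Fin n) : Prop :=
  (∀ a b : boxes S, a.1.1 = b.1.1 → a.1.2 < b.1.2 → T a ≤ T b) ∧
  (∀ a b : boxes S, a.1.2 = b.1.2 → a.1.1 < b.1.1 → T a < T b)

/-- The number of entries of a filling that are equal to `i`. -/
def content (S : SkewPartition) {n : ℕ} (T : boxes S → Fin n) (i : Fin n) : ℕ :=
  (Finset.univ.filter fun b => T b = i).card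

open scoped Classical in
/-- The skew Schur polynomial in `n` variables: the sum of the content monomials of all semistandard
tableaux with `n` symbols. -/
noncomputable def skewSchur (S : SkewPartition) (n : ℕ) : MvPolynomial (Fin n) ℤ :=
  ∑ T ∈ Finset.univ.filter (fun T : boxes S → Fin n => IsSemistandard S T),
    ∏ i : Fin n, MvPolynomial.X i ^ content S T i

/-- The Schur polynomial in `n` variables. -/
noncomputable def schur (lam : YoungDiagram) (n : ℕ) : MvPolynomial (Fin n) ℤ :=
  skewSchur (straight lam) n

/-- `c` lists the coefficients of an expansion of `f` in the Schur polynomials of the partitions of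
length at most `n`. As these Schur polynomials form a `ℤ`-basis of the symmetric polynomials in `n`
variables, a symmetric polynomial `f` has exactly one such `c`. -/
def IsSchurExpansion {n : ℕ} (f : MvPolynomial (Fin n) ℤ) (c : YoungDiagram →₀ ℤ) : Prop :=
  (∀ nu, n < len nu → c nu = 0) ∧ f = c.sum fun nu a => MvPolynomial.C a * schur nu n

/-- The skew Schur polynomial in `n` variables is multiplicity-free: the coefficients of its
expansion in Schur polynomials all belong to `{0, 1}`. -/
def MultiplicityFree (S : SkewPartition) (n : ℕ) : Prop :=
  ∃ c : YoungDiagram →₀ ℤ, IsSchurExpansion (skewSchur S n) c ∧ ∀ nu, c nu = 0 ∨ c nu = 1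

/-! ### Deleting rows and columns -/

theorem exists_count_eq (p : ℕ → Prop) [DecidablePred p] (i : ℕ) (hi : p i) (a : ℕ)
    (ha : a ≤ Nat.count p i) : ∃ i' ≤ i, p i' ∧ Nat.count p i' = a := by
  rcases ha.eq_or_lt with h | h
  · exact ⟨i, le_rfl, hi, h.symm⟩
  · clear hi ha
    induction i with
    | zero => simp at h
    | succ m ih =>
      by_cases hm : a < Nat.count p m
      · obtain ⟨i', h1, h2⟩ := ih hm
        exact ⟨i', by omega, h2⟩
      · rw [Nat.count_succ] at h
        by_cases hp : p m
        · simp only [hp, if_true] at h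
          exact ⟨m, by omega, hp, by omega⟩
        · simp only [hp, if_false] at h
          omega

/-- The Young diagram that remains when the rows in `R` and the columns in `C` are deleted and the
boxes of the other rows and columns are pushed together (a kept row `i` becomes row number
`#{i' < i | i' ∉ R}`, and similarly for columns). -/
def deleteDiagram (R C : Finset ℕ) (lam : YoungDiagram) : YoungDiagram where
  cells := (lam.cells.filter fun b => b.1 ∉ R ∧ b.2 ∉ C).image
    fun b => (Nat.count (· ∉ R) b.1, Nat.count (· ∉ C) b.2)
  isLowerSet := by
    rintro ⟨a, b⟩ ⟨a', b'⟩ ⟨h1, h2⟩ h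
    simp only [Finset.coe_image, Set.mem_image, Finset.mem_coe, Finset.mem_filter, Prod.exists,
      Prod.mk.injEq] at h ⊢
    obtain ⟨i, j, ⟨hm, hi, hj⟩, rfl, rfl⟩ := h
    obtain ⟨i', hi', hpi, hci⟩ := exists_count_eq (· ∉ R) i hi a' h1
    obtain ⟨j', hj', hpj, hcj⟩ := exists_count_eq (· ∉ C) j hj b' h2
    exact ⟨i', j', ⟨lam.up_left_mem hi' hj' hm, hpi, hpj⟩, hci, hcj⟩

/-- Deletion of the rows in `R` and of the columns in `C` from a skew partition. -/
def delete (R C : Finset ℕ) (S : SkewPartition) : SkewPartition where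
  outer := deleteDiagram R C S.outer
  inner := deleteDiagram R C S.inner
  le := Finset.image_subset_image (Finset.filter_subset_filter _ S.le)

/-- The number of boxes of the skew diagram in row `k`. -/
def rowSize (S : SkewPartition) (k : ℕ) : ℕ := ((boxes S).filter fun b => b.1 = k).card

/-- The number of boxes of the skew diagram in column `k`. -/
def colSize (S : SkewPartition) (k : ℕ) : ℕ := ((boxes S).filter fun b => b.2 = k).card

/-! ### Basic -/

/-- No row and no column of the skew diagram is empty; the rows are those of the outer partition,
and so are the columns. -/
def IsBasic (S : SkewPartition) : Prop :=
  (∀ k < len S.outer, rowSize S k ≠ 0) ∧ ∀ k < firstPart S.outer, colSize S k ≠ 0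

/-- The basic demolition: all empty rows and columns are deleted. -/
def basicDemolition (S : SkewPartition) : SkewPartition :=
  delete ((Finset.range (len S.outer)).filter fun k => rowSize S k = 0)
    ((Finset.range (firstPart S.outer)).filter fun k => colSize S k = 0) S

/-! ### Sharp -/

/-- Every column has fewer than `n` boxes. -/
def IsSharp (n : ℕ) (S : SkewPartition) : Prop := ∀ k < firstPart S.outer, colSize S k < n

/-- The `n`-sharp demolition: `∅ / ∅` if some column has more than `n` boxes, and otherwise all
columns with exactly `n` boxes are deleted. -/
def sharpDemolition (n : ℕ) (S : SkewPartition) : SkewPartition :=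
  if ∃ k < firstPart S.outer, n < colSize S k then straight ⊥
  else delete ∅ ((Finset.range (firstPart S.outer)).filter fun k => colSize S k = n) S

/-! ### Tight -/

open scoped Classical in
/-- The invariant `τ`. -/
noncomputable def tau (S : SkewPartition) : ℕ :=
  if S.inner = ⊥ ∨ IsRectangle S.outer then 0
  else firstMult S.outer - min (firstMult S.outer) (len S.inner)

open scoped Classical in
/-- The invariant `σ`. -/
noncomputable def sigma (S : SkewPartition) : ℕ :=
  if S.inner = ⊥ ∨ IsRectangle S.outer then 0
  else lastPart S.outer - min (firstPart S.inner) (lastPart S.outer)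

/-- A basic skew partition with `τ = σ = 0`. -/
def IsTight (S : SkewPartition) : Prop := IsBasic S ∧ tau S = 0 ∧ sigma S = 0

/-- The partition whose parts are those of `lam` without its first `t` parts, each diminished by `s`
(parts that are at most `s` disappear).  If `t` is at most the multiplicity of the largest part, the
omitted parts are `t` copies of the largest part. -/
def trim (t s : ℕ) (lam : YoungDiagram) : YoungDiagram where
  cells := lam.cells.filter fun b => (b.1 + t, b.2 + s) ∈ lam
  isLowerSet := by
    rintro ⟨a, b⟩ ⟨a', b'⟩ ⟨h1, h2⟩ h
    simp only [Finset.mem_coe, Finset.mem_filter, YoungDiagram.mem_cells] at h ⊢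
    exact ⟨lam.up_left_mem h1 h2 h.1,
      lam.up_left_mem (Nat.add_le_add_right h1 t) (Nat.add_le_add_right h2 s) h.2⟩

theorem mem_trim {t s : ℕ} {lam : YoungDiagram} {i j : ℕ} :
    (i, j) ∈ trim t s lam ↔ (i + t, j + s) ∈ lam := by
  rw [← YoungDiagram.mem_cells]
  simp only [trim, Finset.mem_filter, YoungDiagram.mem_cells, and_iff_right_iff_imp]
  exact lam.up_left_mem (Nat.le_add_right _ _) (Nat.le_add_right _ _)

theorem rowLen_eq_of_lt_firstMult {lam : YoungDiagram} {i : ℕ} (hi : i < firstMult lam) :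
    i < len lam ∧ lam.rowLen i = firstPart lam := by
  have hl : firstMult lam ≤ len lam := by
    have := List.count_le_length (a := firstPart lam) (l := lam.rowLens)
    rwa [YoungDiagram.length_rowLens] at this
  refine ⟨hi.trans_le hl, ?_⟩
  by_contra hne
  have hc : firstMult lam = ((Finset.range (len lam)).filter
      fun k => lam.rowLen k = firstPart lam).card := by
    simp only [firstMult, YoungDiagram.rowLens, len, List.count, List.countP_map]
    rw [Finset.card_def, Finset.filter_val, Finset.range_val, Multiset.range, Multiset.filter_coe,
      Multiset.coe_card, List.countP_eq_length_filter]
    congr 1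
  have hsub : ((Finset.range (len lam)).filter fun k => lam.rowLen k = firstPart lam) ⊆
      Finset.range i := by
    intro k hk
    simp only [Finset.mem_filter, Finset.mem_range] at hk ⊢
    by_contra hik
    have h1 := lam.rowLen_anti i k (by omega)
    have h2 := lam.rowLen_anti 0 i (by omega)
    simp only [firstPart] at hk hne
    omega
  have := Finset.card_le_card hsub
  rw [Finset.card_range] at this
  omega

theorem inner_le_trim (S : SkewPartition) : S.inner ≤ trim (tau S) (sigma S) S.outer := by
  rw [← YoungDiagram.cells_subset_iff]
  rintro ⟨i, j⟩ h
  rw [YoungDiagram.mem_cells] at h ⊢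
  rw [mem_trim]
  have hS : (i, j) ∈ S.outer := S.le h
  by_cases hc : S.inner = ⊥ ∨ IsRectangle S.outer
  · simpa [tau, sigma, hc] using hS
  have ht : tau S = firstMult S.outer - min (firstMult S.outer) (len S.inner) := by
    simp [tau, hc]
  have hs : sigma S = lastPart S.outer - min (firstPart S.inner) (lastPart S.outer) := by
    simp [sigma, hc]
  have hi : i < len S.inner := by
    rw [len, ← YoungDiagram.mem_iff_lt_colLen]
    exact S.inner.up_left_mem le_rfl (Nat.zero_le j) h
  have hj : j < firstPart S.inner := by
    rw [firstPart, ← YoungDiagram.mem_iff_lt_rowLen]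
    exact S.inner.up_left_mem (Nat.zero_le i) le_rfl h
  have hio : i < len S.outer := by
    rw [len, ← YoungDiagram.mem_iff_lt_colLen]
    exact S.outer.up_left_mem le_rfl (Nat.zero_le j) hS
  have hlast : ∀ k < len S.outer, lastPart S.outer ≤ S.outer.rowLen k := fun k hk =>
    S.outer.rowLen_anti k _ (by omega)
  have hjo : j < S.outer.rowLen i := by rwa [← YoungDiagram.mem_iff_lt_rowLen]
  have hmax := S.outer.rowLen_anti 0 i (Nat.zero_le i)
  rw [YoungDiagram.mem_iff_lt_rowLen]
  by_cases h0 : tau S = 0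
  · rw [h0, Nat.add_zero]
    have := hlast i hio
    omega
  · have hlt : i + tau S < firstMult S.outer := by omega
    obtain ⟨hk, he⟩ := rowLen_eq_of_lt_firstMult hlt
    have := hlast _ hk
    rw [firstPart] at he
    omega

/-- The tight demolition: `τ` copies of the largest part of the outer partition are omitted, its
other parts are diminished by `σ`, and the basic demolition is applied. -/
noncomputable def tightDemolition (S : SkewPartition) : SkewPartition :=
  basicDemolition ⟨trim (tau S) (sigma S) S.outer, S.inner, inner_le_trim S⟩

/-! ### Ordinary -/

/-- The complement of a partition in the rectangle with `b` rows of length `a`, turned by 180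
degrees. -/
def complement (a b : ℕ) (lam : YoungDiagram) : YoungDiagram where
  cells := (Finset.range b ×ˢ Finset.range a).filter fun c => (b - 1 - c.1, a - 1 - c.2) ∉ lam
  isLowerSet := by
    rintro ⟨i, j⟩ ⟨i', j'⟩ ⟨h1, h2⟩ h
    simp only [Finset.mem_coe, Finset.mem_filter, Finset.mem_product, Finset.mem_range] at h ⊢
    simp only at h1 h2
    exact ⟨⟨by omega, by omega⟩, fun hm => h.2 (lam.up_left_mem (by omega) (by omega) hm)⟩

theorem complement_anti (a b : ℕ) {mu lam : YoungDiagram} (h : mu ≤ lam) :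
    complement a b lam ≤ complement a b mu := by
  rw [← YoungDiagram.cells_subset_iff]
  intro c hc
  simp only [complement, Finset.mem_filter] at hc ⊢
  exact ⟨hc.1, fun hm => hc.2 (h hm)⟩

/-- A basic skew partition whose outer partition has at most one more distinct part than the inner
one, or whose inner partition is empty. -/
def IsOrdinary (S : SkewPartition) : Prop :=
  IsBasic S ∧ (np S.outer ≤ np S.inner + 1 ∨ S.inner = ⊥)

open scoped Classical in
/-- The ordinary reduction: the two partitions are replaced by their complements in the smallest
rectangle that contains the outer one, and exchanged, unless the condition on the distinct parts
holds already. -/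
noncomputable def ordinaryReduction (S : SkewPartition) : SkewPartition :=
  if np S.inner + 1 < np S.outer ∧ S.inner ≠ ⊥ then
    ⟨complement (firstPart S.outer) (len S.outer) S.inner,
      complement (firstPart S.outer) (len S.outer) S.outer, complement_anti _ _ S.le⟩
  else S

/-- The iterated `n`-sharp, basic, tight and ordinary demolition. -/
noncomputable def demolition (n : ℕ) (S : SkewPartition) : SkewPartition :=
  ordinaryReduction (tightDemolition (basicDemolition (sharpDemolition n S)))

/-- The number of rows by which the tight step shortens the partition. -/
noncomputable def demolitionTau (n : ℕ) (S : SkewPartition) : ℕ :=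
  tau (basicDemolition (sharpDemolition n S))

end SkewSchur

namespace SkewSchur

/-! ### Boxes -/

/-! Everything is reduced to Littlewood-Richardson tableaux. Multiply `skewSchur S n` by the
alternant of the staircase. Since the polynomial is symmetric, the product is the sum, over all
semistandard fillings, of the alternants with exponent content plus staircase. Following Stembridge,
the fillings that violate the lattice condition cancel: take the last column from which on the
content is not a partition, the first entry `k` that witnesses this, and apply the Bender-Knuth
involution for `k`, `k + 1` to the columns before it. The exponents at `k` and `k + 1` are
exchanged, so the alternant changes its sign (`alternant_mul_skewSchur`).

For a straight shape only one filling survives, which is the bialternant formula. Alternants with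
distinct strictly decreasing exponents are told apart by their leading coefficients, so a skew Schur
polynomial is multiplicity-free iff its Littlewood-Richardson tableaux are determined by their
contents (`multiplicityFree_iff`).

Each demolition then transports these tableaux in a way that respects equality of tableaux and of
contents (`multiplicityFree_congr`). A column with `n` boxes contains every entry once and is
forced, so its deletion lowers all column counts equally; empty rows and columns play no role
(`multiplicityFree_delete`). If `τ > 0`, the lattice condition forces the smallest possible entries
in the rows of maximal length; hence each column starts with `0, ..., τ - 1`, and these entries may
go, together with `τ` variables (`multiplicityFree_omitRows`). If `σ > 0`, the columns to the right
of the inner partition are forced to carry their row numbers, and `σ` of those of full height may go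
(`multiplicityFree_omitColumns`). The ordinary reduction turns the shape by 180 degrees, which does
not change the symmetric polynomial (`skewSchur_rotate`).

The shape conditions are checked separately. The delicate points are that deleting empty rows and
columns after trimming preserves `τ = σ = 0`, and that these conditions are invariant under
rotation. -/

theorem mem_boxes {S : SkewPartition} {b : ℕ × ℕ} : b ∈ boxes S ↔ b ∈ S.outer ∧ b ∉ S.inner := by
  simp [boxes]

theorem boxes_convex {S : SkewPartition} {i j a b i' j' : ℕ} (h : (i, j) ∈ boxes S)
    (h' : (i', j') ∈ boxes S) (hi : i ≤ a) (hi' : a ≤ i') (hj : j ≤ b) (hj' : b ≤ j') :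
    (a, b) ∈ boxes S := by
  rw [mem_boxes] at *
  exact ⟨S.outer.up_left_mem hi' hj' h'.1, fun hm => h.2 (S.inner.up_left_mem hi hj hm)⟩

theorem lt_len_iff {lam : YoungDiagram} {i : ℕ} : i < len lam ↔ (i, 0) ∈ lam :=
  YoungDiagram.mem_iff_lt_colLen.symm

theorem lt_firstPart_iff {lam : YoungDiagram} {j : ℕ} : j < firstPart lam ↔ (0, j) ∈ lam :=
  YoungDiagram.mem_iff_lt_rowLen.symm

theorem lt_len_of_mem {lam : YoungDiagram} {i j : ℕ} (h : (i, j) ∈ lam) : i < len lam :=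
  lt_len_iff.2 (lam.up_left_mem le_rfl (Nat.zero_le j) h)

theorem lt_firstPart_of_mem {lam : YoungDiagram} {i j : ℕ} (h : (i, j) ∈ lam) :
    j < firstPart lam :=
  lt_firstPart_iff.2 (lam.up_left_mem (Nat.zero_le i) le_rfl h)

/-! ### Tableaux as functions on the quarter plane

Only the values at the boxes of the shape matter. -/

/-- The function `T` restricts to a semistandard filling of `S` with entries below `n`. -/
structure IsTableau (S : SkewPartition) (n : ℕ) (T : ℕ → ℕ → ℕ) : Prop where
  lt : ∀ i j, (i, j) ∈ boxes S → T i j < n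
  row : ∀ i j j', (i, j) ∈ boxes S → (i, j') ∈ boxes S → j < j' → T i j ≤ T i j'
  col : ∀ i i' j, (i, j) ∈ boxes S → (i', j) ∈ boxes S → i < i' → T i j < T i' j

/-- The columns that contain the entry `k`. -/
def colSet (S : SkewPartition) (T : ℕ → ℕ → ℕ) (k : ℕ) : Finset ℕ :=
  ((boxes S).filter fun b => T b.1 b.2 = k).image Prod.snd

/-- The number of entries `k`. -/
def weight (S : SkewPartition) (T : ℕ → ℕ → ℕ) (k : ℕ) : ℕ :=
  ((boxes S).filter fun b => T b.1 b.2 = k).card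

/-- The number of columns with index at least `j` that contain the entry `k`. -/
def tailCount (S : SkewPartition) (T : ℕ → ℕ → ℕ) (j k : ℕ) : ℕ :=
  ((colSet S T k).filter (j ≤ ·)).card

/-- A Littlewood-Richardson tableau: the contents of the columns from any given one on form a
partition. -/
structure IsLR (S : SkewPartition) (n : ℕ) (T : ℕ → ℕ → ℕ) : Prop extends IsTableau S n T where
  lattice : ∀ j k, tailCount S T j (k + 1) ≤ tailCount S T j k

variable {S : SkewPartition} {n : ℕ} {T : ℕ → ℕ → ℕ}

theorem mem_colSet {k j : ℕ} : j ∈ colSet S T k ↔ ∃ i, (i, j) ∈ boxes S ∧ T i j = k := by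
  simp [colSet]

theorem IsTableau.le_of_le (h : IsTableau S n T) {i j i' j' : ℕ} (hb : (i, j) ∈ boxes S)
    (hb' : (i', j') ∈ boxes S) (hi : i ≤ i') (hj : j ≤ j') : T i j ≤ T i' j' := by
  have hm : (i, j') ∈ boxes S := boxes_convex hb hb' le_rfl hi hj le_rfl
  have h1 : T i j ≤ T i j' := by
    rcases hj.eq_or_lt with rfl | hlt
    · exact le_rfl
    · exact h.row _ _ _ hb hm hlt
  have h2 : T i j' ≤ T i' j' := by
    rcases hi.eq_or_lt with rfl | hlt
    · exact le_rfl
    · exact (h.col _ _ _ hm hb' hlt).le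
  exact h1.trans h2

theorem IsTableau.row_unique (h : IsTableau S n T) {i i' j : ℕ} (hb : (i, j) ∈ boxes S)
    (hb' : (i', j) ∈ boxes S) (he : T i j = T i' j) : i = i' := by
  rcases lt_trichotomy i i' with hlt | rfl | hlt
  · exact absurd he (h.col _ _ _ hb hb' hlt).ne
  · rfl
  · exact absurd he (h.col _ _ _ hb' hb hlt).ne'

theorem IsTableau.weight_eq (h : IsTableau S n T) (k : ℕ) :
    weight S T k = (colSet S T k).card := by
  rw [weight, colSet, Finset.card_image_of_injOn]
  rintro ⟨i, j⟩ h1 ⟨i', j'⟩ h2 he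
  simp only [Finset.coe_filter, Set.mem_ofPred_eq] at h1 h2 he
  subst he
  rw [h.row_unique h1.1 h2.1 (h1.2.trans h2.2.symm)]

theorem tailCount_zero (k : ℕ) : tailCount S T 0 k = (colSet S T k).card := by
  simp [tailCount]

theorem tailCount_succ (j k : ℕ) :
    tailCount S T j k = tailCount S T (j + 1) k + if j ∈ colSet S T k then 1 else 0 := by
  have : (colSet S T k).filter (j ≤ ·) =
      (colSet S T k).filter (j + 1 ≤ ·) ∪ (colSet S T k).filter (· = j) := by
    ext a
    simp only [Finset.mem_filter, Finset.mem_union]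
    constructor
    · rintro ⟨h1, h2⟩
      rcases h2.eq_or_lt with rfl | h
      · exact Or.inr ⟨h1, rfl⟩
      · exact Or.inl ⟨h1, h⟩
    · rintro (⟨h1, h2⟩ | ⟨h1, h2⟩)
      · exact ⟨h1, by omega⟩
      · exact ⟨h1, by omega⟩
  rw [tailCount, this, Finset.card_union_of_disjoint, ← tailCount]
  · congr 1
    rw [Finset.filter_eq']
    split_ifs <;> simp
  · rw [Finset.disjoint_filter]
    intro a _ h1 h2
    omega

/-- The entry in row `i` and column `j` is at least the number of boxes above it. -/
theorem IsTableau.le_add_colLen (h : IsTableau S n T) {i j : ℕ} (hb : (i, j) ∈ boxes S) :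
    i ≤ T i j + S.inner.colLen j := by
  induction i with
  | zero => omega
  | succ i ih =>
    by_cases hi : (i, j) ∈ S.inner
    · rw [YoungDiagram.mem_iff_lt_colLen] at hi
      omega
    · have hb' : (i, j) ∈ boxes S :=
        mem_boxes.2 ⟨S.outer.up_left_mem (Nat.le_succ i) le_rfl (mem_boxes.1 hb).1, hi⟩
      have := ih hb'
      have := h.col _ _ _ hb' hb (Nat.lt_succ_self i)
      omega

/-- Induction on the entry: by the lattice condition, an entry `k + 1` in column `j` needs an entry
`k` in some column from `j` on. That box lies in a strictly higher row, because entries weakly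
increase towards the lower right. -/
theorem IsLR.le_row (h : IsLR S n T) {i j : ℕ} (hb : (i, j) ∈ boxes S) : T i j ≤ i := by
  generalize hk : T i j = k
  induction k generalizing i j with
  | zero => omega
  | succ k ih =>
    have h1 : 0 < tailCount S T j (k + 1) :=
      Finset.card_pos.2 ⟨j, Finset.mem_filter.2 ⟨mem_colSet.2 ⟨i, hb, hk⟩, le_rfl⟩⟩
    obtain ⟨j', hj'⟩ := Finset.card_pos.1 (h1.trans_le (h.lattice j k))
    obtain ⟨hj', hle⟩ := Finset.mem_filter.1 hj'
    obtain ⟨i', hb', he⟩ := mem_colSet.1 hj'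
    have := ih hb' he
    by_contra hlt
    have := h.le_of_le hb hb' (by omega) hle
    omega

/-- If the first `p` rows of the outer partition are equally long, then the entries in these rows
are as small as possible. -/
theorem IsLR.eq_of_top_rectangle (h : IsLR S n T) {p : ℕ}
    (hp : ∀ i < p, S.outer.rowLen i = firstPart S.outer) {i j : ℕ} (hi : i < p)
    (hb : (i, j) ∈ boxes S) : T i j + S.inner.colLen j = i := by
  have hmem : ∀ i < p, ∀ j' < firstPart S.outer, (i, j') ∈ S.outer := fun i hi j' hj' => by
    rw [YoungDiagram.mem_iff_lt_rowLen, hp i hi]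
    exact hj'
  -- The columns are treated from right to left, and each column from top to bottom.
  obtain ⟨d, hd⟩ : ∃ d, firstPart S.outer = j + d :=
    ⟨_, (Nat.add_sub_of_le (lt_firstPart_of_mem (mem_boxes.1 hb).1).le).symm⟩
  induction d using Nat.strong_induction_on generalizing i j with
  | _ d ihd =>
  induction i using Nat.strong_induction_on with
  | _ i ihi =>
  have hge := h.le_add_colLen hb
  have hcol := (mem_boxes.1 hb).2
  rw [YoungDiagram.mem_iff_lt_colLen] at hcol
  by_contra hne
  obtain ⟨k, hk⟩ : ∃ k, T i j = k + 1 := ⟨T i j - 1, by omega⟩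
  -- The boxes above are minimal already, so an entry `k + 1` that is too large skips the value `k`
  -- in its column.
  have hnot : j ∉ colSet S T k := by
    rintro hj
    obtain ⟨i', hb', he⟩ := mem_colSet.1 hj
    have hi' : i' < i := by
      by_contra hle
      have := h.le_of_le hb hb' (by omega) le_rfl
      omega
    have := ihi i' hi' (by omega) hb'
    omega
  have hin : j ∈ colSet S T (k + 1) := mem_colSet.2 ⟨i, hb, hk⟩
  have h1 := h.lattice j k
  rw [tailCount_succ j, tailCount_succ j, if_pos hin, if_neg hnot] at h1
  -- The lattice condition now demands more columns with `k` than with `k + 1` to the right of `j`.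
  -- But row `i` has entries at least `k + 1` there, and those columns are minimal down to row `i`,
  -- so all of them contain `k + 1`.
  have h2 : ¬ (colSet S T k).filter (j + 1 ≤ ·) ⊆ (colSet S T (k + 1)).filter (j + 1 ≤ ·) :=
    fun hs => by
      have := Finset.card_le_card hs
      simp only [tailCount] at h1
      omega
  apply h2
  intro j' hj'
  rw [Finset.mem_filter] at hj' ⊢
  refine ⟨?_, hj'.2⟩
  obtain ⟨i', hb', he⟩ := mem_colSet.1 hj'.1
  have hj'L := lt_firstPart_of_mem (mem_boxes.1 hb').1
  have hbi : (i, j') ∈ boxes S := mem_boxes.2 ⟨hmem i hi j' hj'L, fun hm =>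
    (mem_boxes.1 hb).2 (S.inner.up_left_mem le_rfl (by omega) hm)⟩
  have e1 := ihd (firstPart S.outer - j') (by omega) hi hbi (by omega)
  have h3 := h.le_of_le hb hbi le_rfl (by omega)
  have hb2 : (k + 1 + S.inner.colLen j', j') ∈ boxes S := mem_boxes.2
    ⟨S.outer.up_left_mem (by omega) le_rfl (mem_boxes.1 hbi).1, fun hm => by
      rw [YoungDiagram.mem_iff_lt_colLen] at hm
      omega⟩
  have e2 := ihd (firstPart S.outer - j') (by omega) (by omega) hb2 (by omega)
  exact mem_colSet.2 ⟨_, hb2, by omega⟩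

end SkewSchur

namespace SkewSchur

/-! ### The Bender-Knuth involution on the columns before a given one -/

theorem lt_card_filter_range {p : ℕ → Prop} [DecidablePred p] {c : ℕ}
    (hp : ∀ i j, i ≤ j → p j → p i) {j : ℕ} (hj : j < c) :
    j < ((Finset.range c).filter p).card ↔ p j := by
  constructor
  · intro h
    by_contra hn
    have : (Finset.range c).filter p ⊆ Finset.range j := fun a ha => by
      rw [Finset.mem_filter] at ha
      rw [Finset.mem_range]
      by_contra hle
      exact hn (hp j a (by omega) ha.2)
    have := Finset.card_le_card this
    rw [Finset.card_range] at this
    omega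
  · intro h
    have : Finset.range (j + 1) ⊆ (Finset.range c).filter p := fun a ha => by
      rw [Finset.mem_range] at ha
      exact Finset.mem_filter.2 ⟨Finset.mem_range.2 (by omega), hp a j (by omega) h⟩
    have := Finset.card_le_card this
    rw [Finset.card_range] at this
    omega

/-- The number of columns before `c` that in row `i` belong to the inner partition or contain an
entry less than `m`. -/
def rowCount (S : SkewPartition) (T : ℕ → ℕ → ℕ) (c m i : ℕ) : ℕ :=
  ((Finset.range c).filter fun j => (i, j) ∈ S.inner ∨ (i, j) ∈ boxes S ∧ T i j < m).card

variable {S : SkewPartition} {n : ℕ} {T : ℕ → ℕ → ℕ} {c k m : ℕ}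

theorem rowCount_le (m i : ℕ) : rowCount S T c m i ≤ c := by
  simpa [rowCount] using Finset.card_filter_le (Finset.range c)
    (fun j => (i, j) ∈ S.inner ∨ (i, j) ∈ boxes S ∧ T i j < m)

/-- The counted columns form an initial segment, so the row counts encode the entries in the columns
before `c`, like a Gelfand-Tsetlin pattern. -/
theorem IsTableau.lt_rowCount (h : IsTableau S n T) {i j : ℕ} (hj : j < c) :
    j < rowCount S T c m i ↔ (i, j) ∈ S.inner ∨ (i, j) ∈ boxes S ∧ T i j < m := by
  apply lt_card_filter_range _ hj
  rintro a b hab (hb | ⟨hb, hlt⟩)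
  · exact Or.inl (S.inner.up_left_mem le_rfl hab hb)
  · by_cases ha : (i, a) ∈ S.inner
    · exact Or.inl ha
    · have hba : (i, a) ∈ boxes S :=
        mem_boxes.2 ⟨S.outer.up_left_mem le_rfl hab (mem_boxes.1 hb).1, ha⟩
      exact Or.inr ⟨hba, (h.le_of_le hba hb le_rfl hab).trans_lt hlt⟩

theorem IsTableau.lt_rowCount_of_mem (h : IsTableau S n T) {i j : ℕ} (hb : (i, j) ∈ boxes S)
    (hj : j < c) : j < rowCount S T c m i ↔ T i j < m := by
  rw [h.lt_rowCount hj]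
  exact ⟨fun h' => h'.elim (fun hm => absurd hm (mem_boxes.1 hb).2) And.right,
    fun h' => Or.inr ⟨hb, h'⟩⟩

theorem le_of_forall_lt_imp {a b c : ℕ} (ha : a ≤ c) (h : ∀ j < c, j < a → j < b) : a ≤ b := by
  by_contra hlt
  exact absurd (h b (by omega) (by omega)) (lt_irrefl b)

theorem IsTableau.rowCount_mono (h : IsTableau S n T) {m m' : ℕ} (hm : m ≤ m') (i : ℕ) :
    rowCount S T c m i ≤ rowCount S T c m' i := by
  refine le_of_forall_lt_imp (rowCount_le m i) fun j hj => ?_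
  rw [h.lt_rowCount hj, h.lt_rowCount hj]
  exact Or.imp_right (And.imp_right fun h' => h'.trans_le hm)

/-- Columns increase strictly. Together with `rowCount_mono` this gives the interlacing inequalities
behind `toggleLow` and `toggleHigh`. -/
theorem IsTableau.rowCount_succ_le (h : IsTableau S n T) (m i : ℕ) :
    rowCount S T c (m + 1) (i + 1) ≤ rowCount S T c m i := by
  refine le_of_forall_lt_imp (rowCount_le _ _) fun j hj => ?_
  rw [h.lt_rowCount hj, h.lt_rowCount hj]
  rintro (h' | ⟨hb, hlt⟩)
  · exact Or.inl (S.inner.up_left_mem (Nat.le_succ i) le_rfl h')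
  · by_cases ha : (i, j) ∈ S.inner
    · exact Or.inl ha
    · have hba : (i, j) ∈ boxes S :=
        mem_boxes.2 ⟨S.outer.up_left_mem (Nat.le_succ i) le_rfl (mem_boxes.1 hb).1, ha⟩
      have := h.col _ _ _ hba hb (Nat.lt_succ_self i)
      exact Or.inr ⟨hba, by omega⟩

theorem rowCount_len (m : ℕ) : rowCount S T c m (len S.outer) = 0 := by
  rw [rowCount, Finset.card_eq_zero, Finset.filter_eq_empty_iff]
  rintro j - (h | ⟨h, -⟩)
  · exact lt_irrefl _ (lt_len_of_mem (S.le h))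
  · exact lt_irrefl _ (lt_len_of_mem (mem_boxes.1 h).1)

/-- The least admissible value of `rowCount S T c (k + 1) i`, given the other ones. -/
def toggleLow (S : SkewPartition) (T : ℕ → ℕ → ℕ) (c k i : ℕ) : ℕ :=
  max (rowCount S T c (k + 2) (i + 1)) (rowCount S T c k i)

/-- The largest admissible value of `rowCount S T c (k + 1) i`, given the other ones. -/
def toggleHigh (S : SkewPartition) (T : ℕ → ℕ → ℕ) (c k : ℕ) : ℕ → ℕ
  | 0 => rowCount S T c (k + 2) 0
  | i + 1 => min (rowCount S T c (k + 2) (i + 1)) (rowCount S T c k i)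

/-- The reflected value of `rowCount S T c (k + 1) i`. -/
def toggle (S : SkewPartition) (T : ℕ → ℕ → ℕ) (c k i : ℕ) : ℕ :=
  toggleHigh S T c k i + toggleLow S T c k i - rowCount S T c (k + 1) i

/-- The Bender-Knuth involution, applied to the columns before `c`. -/
def benderKnuth (S : SkewPartition) (c k : ℕ) (T : ℕ → ℕ → ℕ) (i j : ℕ) : ℕ :=
  if j < c ∧ (T i j = k ∨ T i j = k + 1) then if j < toggle S T c k i then k else k + 1 else T i j

theorem IsTableau.toggleLow_le (h : IsTableau S n T) (i : ℕ) :
    toggleLow S T c k i ≤ rowCount S T c (k + 1) i :=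
  max_le (h.rowCount_succ_le _ _) (h.rowCount_mono (Nat.le_succ k) i)

theorem IsTableau.le_toggleHigh (h : IsTableau S n T) (i : ℕ) :
    rowCount S T c (k + 1) i ≤ toggleHigh S T c k i := by
  cases i with
  | zero => exact h.rowCount_mono (Nat.le_succ _) 0
  | succ i => exact le_min (h.rowCount_mono (Nat.le_succ _) _) (h.rowCount_succ_le _ _)

theorem toggleHigh_le (i : ℕ) : toggleHigh S T c k i ≤ rowCount S T c (k + 2) i := by
  cases i with
  | zero => exact le_rfl
  | succ i => exact min_le_left _ _

/-- The subtraction in `toggle` does not truncate, so the reflection may be handled as an additive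
identity. -/
theorem IsTableau.toggle_add (h : IsTableau S n T) (i : ℕ) :
    toggle S T c k i + rowCount S T c (k + 1) i = toggleHigh S T c k i + toggleLow S T c k i :=
  Nat.sub_add_cancel ((h.le_toggleHigh i).trans (Nat.le_add_right _ _))

theorem IsTableau.toggleLow_le_toggle (h : IsTableau S n T) (i : ℕ) :
    toggleLow S T c k i ≤ toggle S T c k i := by
  have := h.toggle_add (c := c) (k := k) i
  have := h.le_toggleHigh (c := c) (k := k) i
  omega

theorem IsTableau.toggle_le (h : IsTableau S n T) (i : ℕ) :
    toggle S T c k i ≤ toggleHigh S T c k i := by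
  have := h.toggle_add (c := c) (k := k) i
  have := h.toggleLow_le (c := c) (k := k) i
  omega

theorem benderKnuth_of_le {i j : ℕ} (hj : c ≤ j) : benderKnuth S c k T i j = T i j :=
  if_neg fun h => absurd h.1 (by omega)

theorem benderKnuth_lt_iff {i j : ℕ} (hm : m ≠ k + 1) :
    benderKnuth S c k T i j < m ↔ T i j < m := by
  unfold benderKnuth
  split_ifs with h1 h2 <;> omega

theorem benderKnuth_eq_or (i j : ℕ) : benderKnuth S c k T i j = T i j ∨
    (j < c ∧ (T i j = k ∨ T i j = k + 1) ∧
      (benderKnuth S c k T i j = k ∨ benderKnuth S c k T i j = k + 1)) := by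
  unfold benderKnuth
  split_ifs with h1 h2
  · exact Or.inr ⟨h1.1, h1.2, Or.inl rfl⟩
  · exact Or.inr ⟨h1.1, h1.2, Or.inr rfl⟩
  · exact Or.inl rfl

theorem IsTableau.benderKnuth_lt_succ (h : IsTableau S n T) {i j : ℕ} (hb : (i, j) ∈ boxes S)
    (hj : j < c) : benderKnuth S c k T i j < k + 1 ↔ j < toggle S T c k i := by
  have h1 := h.lt_rowCount_of_mem (m := k) hb hj
  have h2 := h.lt_rowCount_of_mem (m := k + 2) hb hj
  have h3 := (h.toggle_le (k := k) (c := c) i).trans (toggleHigh_le i)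
  have h4 : rowCount S T c k i ≤ toggle S T c k i :=
    (le_max_right _ _).trans (h.toggleLow_le_toggle i)
  unfold benderKnuth
  split_ifs with h5 h6 <;> omega

theorem IsTableau.benderKnuth (h : IsTableau S n T) (hk : k + 1 < n)
    (hc : ∀ i, (i, c) ∈ boxes S → T i c ≠ k) : IsTableau S n (benderKnuth S c k T) where
  lt i j hb := by
    have := h.lt _ _ hb
    rcases benderKnuth_eq_or (S := S) (c := c) (k := k) (T := T) i j with h1 | h1 <;> omega
  row i j j' hb hb' hjj := by
    have hle := h.row _ _ _ hb hb' hjj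
    rcases lt_or_ge j' c with hj' | hj'
    · have h1 := h.benderKnuth_lt_succ (k := k) hb (hjj.trans hj')
      have h2 := h.benderKnuth_lt_succ (k := k) hb' hj'
      have h3 := benderKnuth_eq_or (S := S) (c := c) (k := k) (T := T) i j
      have h4 := benderKnuth_eq_or (S := S) (c := c) (k := k) (T := T) i j'
      omega
    · rw [benderKnuth_of_le hj']
      rcases benderKnuth_eq_or (S := S) (c := c) (k := k) (T := T) i j with h1 | h1
      · omega
      · have hb2 : (i, c) ∈ boxes S := boxes_convex hb hb' le_rfl le_rfl h1.1.le hj'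
        have h2 := hc i hb2
        have h3 := h.le_of_le hb hb2 le_rfl h1.1.le
        have h4 := h.le_of_le hb2 hb' le_rfl hj'
        omega
  col i i' j hb hb' hii := by
    have hlt := h.col _ _ _ hb hb' hii
    rcases lt_or_ge j c with hj | hj
    · have h3 := benderKnuth_eq_or (S := S) (c := c) (k := k) (T := T) i j
      have h4 := benderKnuth_eq_or (S := S) (c := c) (k := k) (T := T) i' j
      -- Only an entry `k` directly above `k + 1` is in danger. The neighbouring rows enter
      -- `toggleLow` and `toggleHigh` just so that both entries of such a pair stay fixed.
      by_cases hcase : T i j = k ∧ T i' j = k + 1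
      · have hi' : i' = i + 1 := by
          by_contra hne
          have hb2 : (i + 1, j) ∈ boxes S := boxes_convex hb hb' (by omega) (by omega) le_rfl le_rfl
          have := h.col _ _ _ hb hb2 (by omega)
          have := h.col _ _ _ hb2 hb' (by omega)
          omega
        subst hi'
        have h1 := h.benderKnuth_lt_succ (k := k) hb hj
        have h2 := h.benderKnuth_lt_succ (k := k) hb' hj
        have h5 : rowCount S T c (k + 2) (i + 1) ≤ toggle S T c k i :=
          (le_max_left _ _).trans (h.toggleLow_le_toggle i)
        have h6 : toggle S T c k (i + 1) ≤ rowCount S T c k i :=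
          (h.toggle_le (i + 1)).trans (min_le_right _ _)
        have h7 := h.lt_rowCount_of_mem (m := k) hb hj
        have h8 := h.lt_rowCount_of_mem (m := k + 2) hb' hj
        omega
      · omega
    · rwa [benderKnuth_of_le hj, benderKnuth_of_le hj]

/-! ### Involutivity of the Bender-Knuth map and its effect on the content -/

theorem rowCount_benderKnuth_of_ne (hm : m ≠ k + 1) (i : ℕ) :
    rowCount S (benderKnuth S c k T) c m i = rowCount S T c m i := by
  simp only [rowCount, benderKnuth_lt_iff hm]

theorem IsTableau.rowCount_benderKnuth (h : IsTableau S n T)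
    (h' : IsTableau S n (SkewSchur.benderKnuth S c k T)) (i : ℕ) :
    rowCount S (SkewSchur.benderKnuth S c k T) c (k + 1) i = toggle S T c k i := by
  have hhigh := (h.toggle_le (k := k) (c := c) i).trans (toggleHigh_le i)
  have hlow : rowCount S T c k i ≤ toggle S T c k i :=
    (le_max_right _ _).trans (h.toggleLow_le_toggle i)
  have hiff : ∀ j < c, j < rowCount S (SkewSchur.benderKnuth S c k T) c (k + 1) i ↔
      j < toggle S T c k i := by
    intro j hj
    by_cases hb : (i, j) ∈ boxes S
    · rw [h'.lt_rowCount_of_mem hb hj, h.benderKnuth_lt_succ hb hj]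
    · have h1 := h.lt_rowCount (m := k) (i := i) hj
      have h2 := h.lt_rowCount (m := k + 2) (i := i) hj
      rw [h'.lt_rowCount hj]
      simp only [hb, false_and, or_false] at h1 h2 ⊢
      rw [← h1]
      rw [← h1] at h2
      omega
  apply le_antisymm
  · exact le_of_forall_lt_imp (rowCount_le _ _) fun j hj => (hiff j hj).1
  · exact le_of_forall_lt_imp (hhigh.trans (rowCount_le _ _)) fun j hj => (hiff j hj).2

/-- The bounds of the reflection involve only the counts for `k` and `k + 2`, which do not change;
reflecting twice between the same bounds is the identity. -/
theorem IsTableau.benderKnuth_benderKnuth (h : IsTableau S n T)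
    (h' : IsTableau S n (SkewSchur.benderKnuth S c k T)) {i j : ℕ} (hb : (i, j) ∈ boxes S) :
    SkewSchur.benderKnuth S c k (SkewSchur.benderKnuth S c k T) i j = T i j := by
  rcases lt_or_ge j c with hj | hj
  · have h1 := h'.benderKnuth_lt_succ (k := k) hb hj
    have ht : toggle S (SkewSchur.benderKnuth S c k T) c k i = rowCount S T c (k + 1) i := by
      have e1 := h'.toggle_add (c := c) (k := k) i
      have e2 := h.toggle_add (c := c) (k := k) i
      have e3 : toggleHigh S (SkewSchur.benderKnuth S c k T) c k i = toggleHigh S T c k i := by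
        cases i <;> simp only [toggleHigh, rowCount_benderKnuth_of_ne (show k + 2 ≠ k + 1 by omega),
          rowCount_benderKnuth_of_ne (show k ≠ k + 1 by omega)]
      have e4 : toggleLow S (SkewSchur.benderKnuth S c k T) c k i = toggleLow S T c k i := by
        simp only [toggleLow, rowCount_benderKnuth_of_ne (show k + 2 ≠ k + 1 by omega),
          rowCount_benderKnuth_of_ne (show k ≠ k + 1 by omega)]
      rw [h.rowCount_benderKnuth h'] at e1
      omega
    rw [ht, h.lt_rowCount_of_mem hb hj] at h1
    have h3 := benderKnuth_eq_or (S := S) (c := c) (k := k) (T := T) i j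
    have h4 := benderKnuth_eq_or (S := S) (c := c) (k := k) (T := SkewSchur.benderKnuth S c k T) i j
    omega
  · rw [benderKnuth_of_le hj, benderKnuth_of_le hj]

/-- The number of entries `k` in the columns before `c`. -/
def headWeight (S : SkewPartition) (T : ℕ → ℕ → ℕ) (c k : ℕ) : ℕ :=
  ((boxes S).filter fun b => b.2 < c ∧ T b.1 b.2 = k).card

/-- `headWeight` counts boxes and `tailCount` counts columns; they fit together because an entry
occurs at most once in a column. -/
theorem IsTableau.weight_eq_head_add_tail (h : IsTableau S n T) (c k : ℕ) :
    weight S T k = headWeight S T c k + tailCount S T c k := by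
  have : tailCount S T c k = ((boxes S).filter fun b => c ≤ b.2 ∧ T b.1 b.2 = k).card := by
    rw [tailCount, colSet, Finset.filter_image, Finset.card_image_of_injOn, Finset.filter_filter]
    · congr 1
      ext b
      simp only [Finset.mem_filter]
      tauto
    · rintro ⟨i, j⟩ h1 ⟨i', j'⟩ h2 he
      simp only [Finset.coe_filter, Finset.mem_filter, Set.mem_ofPred_eq] at h1 h2 he
      subst he
      rw [h.row_unique h1.1.1 h2.1.1 (h1.1.2.trans h2.1.2.symm)]
  rw [this, weight, headWeight, ← Finset.card_union_of_disjoint]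
  · congr 1
    ext b
    simp only [Finset.mem_filter, Finset.mem_union]
    constructor
    · rintro ⟨h1, h2⟩
      rcases lt_or_ge b.2 c with h3 | h3
      · exact Or.inl ⟨h1, h3, h2⟩
      · exact Or.inr ⟨h1, h3, h2⟩
    · rintro (⟨h1, h2, h3⟩ | ⟨h1, h2, h3⟩) <;> exact ⟨h1, h3⟩
  · rw [Finset.disjoint_filter]
    rintro b - ⟨h1, -⟩ ⟨h2, -⟩
    omega

theorem sum_rowCount_add (m : ℕ) :
    (∑ i ∈ Finset.range (len S.outer), rowCount S T c m i) + headWeight S T c m =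
      ∑ i ∈ Finset.range (len S.outer), rowCount S T c (m + 1) i := by
  have hw : headWeight S T c m = ∑ i ∈ Finset.range (len S.outer),
      ((Finset.range c).filter fun j => (i, j) ∈ boxes S ∧ T i j = m).card := by
    rw [headWeight, ← Finset.card_sigma]
    refine Finset.card_bij' (fun b _ => ⟨b.1, b.2⟩) (fun b _ => (b.1, b.2)) ?_ ?_ ?_ ?_
    · rintro ⟨i, j⟩ hb
      simp only [Finset.mem_filter, Finset.mem_sigma, Finset.mem_range] at hb ⊢
      exact ⟨lt_len_of_mem (mem_boxes.1 hb.1).1, hb.2.1, hb.1, hb.2.2⟩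
    · rintro ⟨i, j⟩ hb
      simp only [Finset.mem_filter, Finset.mem_sigma, Finset.mem_range] at hb ⊢
      exact ⟨hb.2.2.1, hb.2.1, hb.2.2.2⟩
    · intros; rfl
    · intros; rfl
  rw [hw, ← Finset.sum_add_distrib]
  refine Finset.sum_congr rfl fun i _ => ?_
  rw [rowCount, rowCount, ← Finset.card_union_of_disjoint]
  · congr 1
    ext j
    simp only [Finset.mem_union, Finset.mem_filter, Finset.mem_range, Nat.lt_succ_iff,
      le_iff_lt_or_eq]
    tauto
  · rw [Finset.disjoint_filter]
    rintro j - (h1 | ⟨-, h1⟩) ⟨hb, h2⟩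
    · exact (mem_boxes.1 hb).2 h1
    · omega

/-- The upper bound in row `i + 1` and the lower bound in row `i` are the minimum and the maximum of
the same two numbers, so the sum telescopes up to boundary terms. -/
theorem sum_toggleHigh_add_toggleLow (N : ℕ) :
    (∑ i ∈ Finset.range (N + 1), (toggleHigh S T c k i + toggleLow S T c k i)) +
      rowCount S T c k N =
    (∑ i ∈ Finset.range (N + 1), (rowCount S T c (k + 2) i + rowCount S T c k i)) +
      toggleLow S T c k N := by
  induction N with
  | zero => simp [toggleHigh]; omega
  | succ N ih =>
    rw [Finset.sum_range_succ, Finset.sum_range_succ _ (N + 1)]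
    have : toggleHigh S T c k (N + 1) + toggleLow S T c k N =
        rowCount S T c (k + 2) (N + 1) + rowCount S T c k N := min_add_max _ _
    omega

theorem IsTableau.sum_toggle_add (h : IsTableau S n T) :
    (∑ i ∈ Finset.range (len S.outer), toggle S T c k i) +
      ∑ i ∈ Finset.range (len S.outer), rowCount S T c (k + 1) i =
    (∑ i ∈ Finset.range (len S.outer), rowCount S T c (k + 2) i) +
      ∑ i ∈ Finset.range (len S.outer), rowCount S T c k i := by
  rw [← Finset.sum_add_distrib, ← Finset.sum_add_distrib,
    Finset.sum_congr rfl fun i _ => h.toggle_add i]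
  rcases hN : len S.outer with _ | N
  · simp
  · have h1 := sum_toggleHigh_add_toggleLow (S := S) (T := T) (c := c) (k := k) N
    -- Row `N` is the last one, and the empty row below it contributes `0` to the maximum.
    have h2 : toggleLow S T c k N = rowCount S T c k N := by
      rw [toggleLow, ← hN, rowCount_len, Nat.zero_max]
    omega

/-- Head weights are differences of consecutive sums of row counts, and the reflection moves the
middle sum to its mirror image between the outer two. -/
theorem IsTableau.headWeight_benderKnuth (h : IsTableau S n T)
    (h' : IsTableau S n (SkewSchur.benderKnuth S c k T)) :
    headWeight S (SkewSchur.benderKnuth S c k T) c k = headWeight S T c (k + 1) ∧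
      headWeight S (SkewSchur.benderKnuth S c k T) c (k + 1) = headWeight S T c k := by
  have e0 := h.sum_toggle_add (c := c) (k := k)
  have e1 := sum_rowCount_add (S := S) (T := T) (c := c) k
  have e2 := sum_rowCount_add (S := S) (T := T) (c := c) (k + 1)
  have e3 := sum_rowCount_add (S := S) (T := SkewSchur.benderKnuth S c k T) (c := c) k
  have e4 := sum_rowCount_add (S := S) (T := SkewSchur.benderKnuth S c k T) (c := c) (k + 1)
  simp only [h.rowCount_benderKnuth h', rowCount_benderKnuth_of_ne (show k + 1 + 1 ≠ k + 1 by omega),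
    rowCount_benderKnuth_of_ne (show k ≠ k + 1 by omega)] at e3 e4
  rw [show k + 1 + 1 = k + 2 from rfl] at e2 e4
  constructor <;> omega

theorem headWeight_benderKnuth_of_ne (h1 : m ≠ k) (h2 : m ≠ k + 1) :
    headWeight S (benderKnuth S c k T) c m = headWeight S T c m := by
  have : ∀ i j, benderKnuth S c k T i j = m ↔ T i j = m := fun i j => by
    have := benderKnuth_eq_or (S := S) (c := c) (k := k) (T := T) i j
    omega
  simp only [headWeight, this]

theorem colSet_benderKnuth_filter {c' : ℕ} (hc : c ≤ c') (m : ℕ) :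
    (colSet S (benderKnuth S c k T) m).filter (c' ≤ ·) = (colSet S T m).filter (c' ≤ ·) := by
  ext j
  simp only [Finset.mem_filter, mem_colSet]
  refine and_congr_left fun hj => ?_
  simp only [benderKnuth_of_le (hc.trans hj)]

theorem tailCount_benderKnuth {c' : ℕ} (hc : c ≤ c') (m : ℕ) :
    tailCount S (benderKnuth S c k T) c' m = tailCount S T c' m := by
  rw [tailCount, tailCount, colSet_benderKnuth_filter hc]

end SkewSchur

namespace SkewSchur

/-! ### The sign-reversing involution on the tableaux that are not Littlewood-Richardson -/

/-- `c` is the last column from which on the content is not a partition, and `k` is the first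
entry that witnesses this. -/
structure IsCritical (S : SkewPartition) (T : ℕ → ℕ → ℕ) (c k : ℕ) : Prop where
  lt : tailCount S T c k < tailCount S T c (k + 1)
  le_of_gt : ∀ c', c < c' → ∀ k', tailCount S T c' (k' + 1) ≤ tailCount S T c' k'
  le_of_lt : ∀ k' < k, tailCount S T c (k' + 1) ≤ tailCount S T c k'

variable {S : SkewPartition} {n : ℕ} {T : ℕ → ℕ → ℕ} {c k : ℕ}

theorem IsCritical.unique {c' k' : ℕ} (h : IsCritical S T c k) (h' : IsCritical S T c' k') :
    c = c' ∧ k = k' := by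
  have hc : c = c' := by
    rcases lt_trichotomy c c' with hlt | rfl | hlt
    · exact absurd (h.le_of_gt _ hlt k') h'.lt.not_ge
    · rfl
    · exact absurd (h'.le_of_gt _ hlt k) h.lt.not_ge
  subst hc
  refine ⟨rfl, ?_⟩
  rcases lt_trichotomy k k' with hlt | rfl | hlt
  · exact absurd (h'.le_of_lt _ hlt) h.lt.not_ge
  · rfl
  · exact absurd (h.le_of_lt _ hlt) h'.lt.not_ge

theorem exists_isCritical (h : ¬ ∀ j k, tailCount S T j (k + 1) ≤ tailCount S T j k) :
    ∃ c k, IsCritical S T c k := by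
  classical
  push Not at h
  obtain ⟨j, k, hjk⟩ := h
  let P : ℕ → Prop := fun c => ∃ k, tailCount S T c k < tailCount S T c (k + 1)
  have hbound : ∀ c, P c → c ≤ firstPart S.outer := by
    rintro c ⟨k, hk⟩
    obtain ⟨j, hj⟩ := Finset.card_pos.1 ((Nat.zero_le _).trans_lt hk)
    rw [Finset.mem_filter, mem_colSet] at hj
    obtain ⟨⟨i, hb, -⟩, hle⟩ := hj
    exact hle.trans (lt_firstPart_of_mem (mem_boxes.1 hb).1).le
  have hP : P (Nat.findGreatest P (firstPart S.outer)) :=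
    Nat.findGreatest_spec (hbound j ⟨k, hjk⟩) ⟨k, hjk⟩
  refine ⟨_, Nat.find hP, Nat.find_spec hP, fun c' hc' k' => ?_, fun k' hk' => ?_⟩
  · by_contra hlt
    have hp : P c' := ⟨k', not_le.1 hlt⟩
    exact Nat.findGreatest_is_greatest hc' (hbound c' hp) hp
  · exact not_lt.1 (Nat.find_min hP hk')

/-- All the conditions concern the columns from `c` on, which the map leaves alone. Hence a second
application uses the same `c` and `k`. -/
theorem IsCritical.benderKnuth (h : IsCritical S T c k) :
    IsCritical S (benderKnuth S c k T) c k where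
  lt := by simpa only [tailCount_benderKnuth le_rfl] using h.lt
  le_of_gt c' hc' k' := by simpa only [tailCount_benderKnuth hc'.le] using h.le_of_gt c' hc' k'
  le_of_lt k' hk' := by simpa only [tailCount_benderKnuth le_rfl] using h.le_of_lt k' hk'

/-- One column changes each count by at most one, so the inequality valid from `c + 1` on can fail
at `c` only if column `c` contains `k + 1` but not `k`. -/
theorem IsCritical.tailCount_eq (h : IsCritical S T c k) :
    tailCount S T c (k + 1) = tailCount S T c k + 1 ∧ c ∉ colSet S T k := by
  have h1 := h.lt
  have h2 := h.le_of_gt (c + 1) (Nat.lt_succ_self c) k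
  rw [tailCount_succ c k, tailCount_succ c (k + 1)] at h1 ⊢
  split_ifs at h1 ⊢ <;> first | omega | exact ⟨by omega, by assumption⟩

theorem IsCritical.lt_n (h : IsCritical S T c k) (hT : IsTableau S n T) : k + 1 < n := by
  obtain ⟨j, hj⟩ := Finset.card_pos.1 ((Nat.zero_le _).trans_lt h.lt)
  rw [Finset.mem_filter, mem_colSet] at hj
  obtain ⟨⟨i, hb, he⟩, -⟩ := hj
  exact he ▸ hT.lt _ _ hb

theorem IsCritical.isTableau (h : IsCritical S T c k) (hT : IsTableau S n T) :
    IsTableau S n (SkewSchur.benderKnuth S c k T) :=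
  hT.benderKnuth (h.lt_n hT) fun i hb he => h.tailCount_eq.2 (mem_colSet.2 ⟨i, hb, he⟩)

/-- The head weights are exchanged, while the tails, which differ by one, stay. The discrepancy of
one is exactly the difference of consecutive staircase exponents. -/
theorem IsCritical.weight_benderKnuth (h : IsCritical S T c k) (hT : IsTableau S n T) :
    weight S (SkewSchur.benderKnuth S c k T) k + 1 = weight S T (k + 1) ∧
      weight S (SkewSchur.benderKnuth S c k T) (k + 1) = weight S T k + 1 ∧
      ∀ m, m ≠ k → m ≠ k + 1 → weight S (SkewSchur.benderKnuth S c k T) m = weight S T m := by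
  have h' := h.isTableau hT
  obtain ⟨e1, e2⟩ := hT.headWeight_benderKnuth h'
  have e3 := h.tailCount_eq.1
  refine ⟨?_, ?_, fun m h1 h2 => ?_⟩
  · rw [h'.weight_eq_head_add_tail c, hT.weight_eq_head_add_tail c, tailCount_benderKnuth le_rfl]
    omega
  · rw [h'.weight_eq_head_add_tail c, hT.weight_eq_head_add_tail c, tailCount_benderKnuth le_rfl]
    omega
  · rw [h'.weight_eq_head_add_tail c, hT.weight_eq_head_add_tail c, tailCount_benderKnuth le_rfl,
      headWeight_benderKnuth_of_ne h1 h2]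

/-! ### Fillings and functions -/

/-- A filling of the boxes, extended by `0` to the quarter plane. -/
def extend (S : SkewPartition) {n : ℕ} (T : boxes S → Fin n) (i j : ℕ) : ℕ :=
  if h : (i, j) ∈ boxes S then T ⟨(i, j), h⟩ else 0

/-- The filling given by a function on the quarter plane. -/
def restrict (S : SkewPartition) {n : ℕ} (T : ℕ → ℕ → ℕ)
    (h : ∀ i j, (i, j) ∈ boxes S → T i j < n) (b : boxes S) : Fin n :=
  ⟨T b.1.1 b.1.2, h _ _ b.2⟩

theorem extend_of_mem {F : boxes S → Fin n} {i j : ℕ} (h : (i, j) ∈ boxes S) :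
    extend S F i j = F ⟨(i, j), h⟩ := dif_pos h

theorem extend_restrict {h : ∀ i j, (i, j) ∈ boxes S → T i j < n} {i j : ℕ}
    (hb : (i, j) ∈ boxes S) : extend S (restrict S T h) i j = T i j := by
  rw [extend_of_mem hb, restrict]

theorem isSemistandard_iff {F : boxes S → Fin n} :
    IsSemistandard S F ↔ IsTableau S n (extend S F) := by
  constructor
  · intro h
    refine ⟨fun i j hb => ?_, fun i j j' hb hb' hlt => ?_, fun i i' j hb hb' hlt => ?_⟩
    · rw [extend_of_mem hb]
      exact Fin.is_lt _
    · rw [extend_of_mem hb, extend_of_mem hb']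
      exact h.1 ⟨_, hb⟩ ⟨_, hb'⟩ rfl hlt
    · rw [extend_of_mem hb, extend_of_mem hb']
      exact h.2 ⟨_, hb⟩ ⟨_, hb'⟩ rfl hlt
  · intro h
    constructor
    · rintro ⟨⟨i, j⟩, hb⟩ ⟨⟨i', j'⟩, hb'⟩ (rfl : i = i') hlt
      have := h.row _ _ _ hb hb' hlt
      rwa [extend_of_mem hb, extend_of_mem hb'] at this
    · rintro ⟨⟨i, j⟩, hb⟩ ⟨⟨i', j'⟩, hb'⟩ (rfl : j = j') hlt
      have := h.col _ _ _ hb hb' hlt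
      rwa [extend_of_mem hb, extend_of_mem hb'] at this

theorem IsTableau.congr {T' : ℕ → ℕ → ℕ} (h : IsTableau S n T)
    (he : ∀ i j, (i, j) ∈ boxes S → T' i j = T i j) : IsTableau S n T' where
  lt i j hb := by rw [he _ _ hb]; exact h.lt _ _ hb
  row i j j' hb hb' := by rw [he _ _ hb, he _ _ hb']; exact h.row _ _ _ hb hb'
  col i i' j hb hb' := by rw [he _ _ hb, he _ _ hb']; exact h.col _ _ _ hb hb'

theorem weight_congr {T' : ℕ → ℕ → ℕ} (he : ∀ i j, (i, j) ∈ boxes S → T' i j = T i j) (k : ℕ) :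
    weight S T' k = weight S T k := by
  rw [weight, weight]
  congr 1
  exact Finset.filter_congr fun b hb => by rw [he _ _ hb]

theorem colSet_congr {T' : ℕ → ℕ → ℕ} (he : ∀ i j, (i, j) ∈ boxes S → T' i j = T i j) (k : ℕ) :
    colSet S T' k = colSet S T k := by
  rw [colSet, colSet]
  congr 1
  exact Finset.filter_congr fun b hb => by rw [he _ _ hb]

theorem tailCount_congr {T' : ℕ → ℕ → ℕ} (he : ∀ i j, (i, j) ∈ boxes S → T' i j = T i j)
    (j k : ℕ) : tailCount S T' j k = tailCount S T j k := by
  rw [tailCount, tailCount, colSet_congr he]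

theorem IsLR.congr {T' : ℕ → ℕ → ℕ} (h : IsLR S n T)
    (he : ∀ i j, (i, j) ∈ boxes S → T' i j = T i j) : IsLR S n T' where
  toIsTableau := h.toIsTableau.congr he
  lattice j k := by simpa only [tailCount_congr he] using h.lattice j k

theorem IsCritical.congr {T' : ℕ → ℕ → ℕ} (h : IsCritical S T c k)
    (he : ∀ i j, (i, j) ∈ boxes S → T' i j = T i j) : IsCritical S T' c k where
  lt := by simpa only [tailCount_congr he] using h.lt
  le_of_gt c' hc' k' := by simpa only [tailCount_congr he] using h.le_of_gt c' hc' k'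
  le_of_lt k' hk' := by simpa only [tailCount_congr he] using h.le_of_lt k' hk'

theorem benderKnuth_congr {T' : ℕ → ℕ → ℕ} (he : ∀ i j, (i, j) ∈ boxes S → T' i j = T i j)
    {i j : ℕ} (hb : (i, j) ∈ boxes S) :
    SkewSchur.benderKnuth S c k T' i j = SkewSchur.benderKnuth S c k T i j := by
  have hr : ∀ m i, rowCount S T' c m i = rowCount S T c m i := fun m i => by
    rw [rowCount, rowCount]
    congr 1
    refine Finset.filter_congr fun j _ => or_congr_right (and_congr_right fun hb => ?_)
    rw [he _ _ hb]
  have ht : toggle S T' c k i = toggle S T c k i := by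
    cases i <;> simp only [toggle, toggleHigh, toggleLow, hr]
  rw [SkewSchur.benderKnuth, SkewSchur.benderKnuth, he _ _ hb, ht]

theorem content_eq_weight {F : boxes S → Fin n} (k : Fin n) :
    content S F k = weight S (extend S F) k := by
  rw [content, weight]
  refine Finset.card_bij (fun b _ => b.1) ?_ ?_ ?_
  · rintro ⟨⟨i, j⟩, hb⟩ h
    simp only [Finset.mem_filter, Finset.mem_univ, true_and] at h ⊢
    exact ⟨hb, by rw [extend_of_mem hb, h]⟩
  · rintro a - b - h
    exact Subtype.ext h
  · rintro ⟨i, j⟩ h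
    rw [Finset.mem_filter] at h
    refine ⟨⟨(i, j), h.1⟩, ?_, rfl⟩
    simp only [Finset.mem_filter, Finset.mem_univ, true_and]
    rw [extend_of_mem h.1] at h
    exact Fin.ext h.2

theorem restrict_extend_eq {F : boxes S → Fin n} {T : ℕ → ℕ → ℕ}
    (h : ∀ i j, (i, j) ∈ boxes S → T i j < n)
    (he : ∀ i j, (i, j) ∈ boxes S → T i j = extend S F i j) : restrict S T h = F := by
  funext ⟨⟨i, j⟩, hb⟩
  apply Fin.ext
  exact (he _ _ hb).trans (extend_of_mem hb)

end SkewSchur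

namespace SkewSchur

open MvPolynomial

/-! ### Alternants -/

/-- The alternant `∑ σ, sign σ * x ^ (α ∘ σ)`. -/
noncomputable def alternant {n : ℕ} (α : Fin n → ℕ) : MvPolynomial (Fin n) ℤ :=
  (Matrix.of fun i j : Fin n => (X j : MvPolynomial (Fin n) ℤ) ^ α i).det

theorem alternant_eq_sum {n : ℕ} (α : Fin n → ℕ) : alternant α =
    ∑ σ : Equiv.Perm (Fin n), (Equiv.Perm.sign σ : MvPolynomial (Fin n) ℤ) *
      ∏ i, (X i : MvPolynomial (Fin n) ℤ) ^ α (σ i) := by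
  rw [alternant, Matrix.det_apply']
  rfl

theorem alternant_comp_swap {n : ℕ} (α : Fin n → ℕ) {a b : Fin n} (h : a ≠ b) :
    alternant (α ∘ Equiv.swap a b) = -alternant α := by
  have := Matrix.det_permute (Equiv.swap a b)
    (Matrix.of fun i j : Fin n => (X j : MvPolynomial (Fin n) ℤ) ^ α i)
  rw [Equiv.Perm.sign_swap h] at this
  exact this.trans (by simp [alternant])

theorem coeff_alternant {n : ℕ} {α β : Fin n → ℕ} (hα : StrictAnti α) (hβ : StrictAnti β) :
    coeff (Finsupp.equivFunOnFinite.symm β) (alternant α) = if α = β then 1 else 0 := by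
  have key : ∀ σ : Equiv.Perm (Fin n),
      coeff (Finsupp.equivFunOnFinite.symm β)
        ((Equiv.Perm.sign σ : MvPolynomial (Fin n) ℤ) *
          ∏ i, (X i : MvPolynomial (Fin n) ℤ) ^ α (σ i)) =
      if β = α ∘ σ then (Equiv.Perm.sign σ : ℤ) else 0 := by
    intro σ
    have e1 : ∏ i, (X i : MvPolynomial (Fin n) ℤ) ^ α (σ i) =
        monomial (Finsupp.equivFunOnFinite.symm (α ∘ σ)) 1 := by
      rw [monomial_eq, C_1, one_mul, Finsupp.prod_fintype _ _ fun i => pow_zero _]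
      rfl
    have e2 : (Equiv.Perm.sign σ : MvPolynomial (Fin n) ℤ) = C ((Equiv.Perm.sign σ : ℤˣ) : ℤ) := by
      simp
    rw [e1, e2, coeff_C_mul, coeff_monomial]
    by_cases h : β = α ∘ σ
    · simp [h]
    · rw [if_neg h, if_neg, mul_zero]
      exact fun h' => h (Finsupp.equivFunOnFinite.symm.injective h').symm
  rw [alternant_eq_sum, coeff_sum, Finset.sum_congr rfl fun σ _ => key σ]
  -- Two strictly decreasing vectors that are rearrangements of each other have the same range,
  -- hence coincide; injectivity then leaves only the identity permutation.
  have hone : ∀ σ : Equiv.Perm (Fin n), β = α ∘ σ → α = β ∧ σ = 1 := by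
    intro σ hσ
    have hr : Set.range (OrderDual.toDual ∘ β) = Set.range (OrderDual.toDual ∘ α) := by
      rw [hσ, ← Function.comp_assoc, EquivLike.range_comp]
    have he : OrderDual.toDual ∘ β = OrderDual.toDual ∘ α :=
      (hβ.dual_right.range_inj hα.dual_right).1 hr
    have he' : β = α := he
    refine ⟨he'.symm, Equiv.ext fun i => hα.injective ?_⟩
    have := congrFun hσ i
    rw [he'] at this
    exact this.symm
  rw [Finset.sum_eq_single 1]
  · by_cases h : α = β
    · simp [h]
    · rw [if_neg h, if_neg fun h' => h (hone 1 h').1]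
  · intro σ _ hσ
    exact if_neg fun h' => hσ (hone σ h').2
  · simp

/-- The exponent vector `(n - 1, ..., 1, 0)`. -/
def staircase (n : ℕ) (i : Fin n) : ℕ := n - 1 - i

theorem staircase_strictAnti (n : ℕ) : StrictAnti (staircase n) := by
  intro i j hij
  have := i.2
  have := j.2
  simp only [staircase]
  omega

theorem alternant_staircase_ne_zero (n : ℕ) : alternant (staircase n) ≠ 0 := by
  intro h
  have := coeff_alternant (staircase_strictAnti n) (staircase_strictAnti n)
  rw [h] at this
  simp at this

/-! ### Symmetry -/

open scoped Classical in
/-- The finset of all semistandard fillings. -/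
noncomputable def tableaux (S : SkewPartition) (n : ℕ) : Finset (boxes S → Fin n) :=
  Finset.univ.filter fun T => IsSemistandard S T

theorem mem_tableaux {S : SkewPartition} {n : ℕ} {F : boxes S → Fin n} :
    F ∈ tableaux S n ↔ IsTableau S n (extend S F) := by
  simp [tableaux, isSemistandard_iff]

variable {S : SkewPartition} {n : ℕ}

theorem restrict_mem_tableaux {T : ℕ → ℕ → ℕ} (h : IsTableau S n T) :
    restrict S T h.lt ∈ tableaux S n :=
  mem_tableaux.2 (h.congr fun _ _ hb => extend_restrict hb)

theorem skewSchur_eq : skewSchur S n = ∑ F ∈ tableaux S n, ∏ i, X i ^ content S F i := rfl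

theorem IsTableau.benderKnuth_full {T : ℕ → ℕ → ℕ} (h : IsTableau S n T) {k : ℕ} (hk : k + 1 < n) :
    IsTableau S n (SkewSchur.benderKnuth S (firstPart S.outer) k T) :=
  h.benderKnuth hk fun _ hb => absurd (lt_firstPart_of_mem (mem_boxes.1 hb).1) (lt_irrefl _)

theorem IsTableau.weight_benderKnuth_full {T : ℕ → ℕ → ℕ} (h : IsTableau S n T) {k : ℕ}
    (hk : k + 1 < n) (m : ℕ) : weight S (SkewSchur.benderKnuth S (firstPart S.outer) k T) m =
      weight S T (Equiv.swap k (k + 1) m) := by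
  have hw : ∀ T m, weight S T m = headWeight S T (firstPart S.outer) m := fun T m => by
    rw [weight, headWeight]
    congr 1
    refine Finset.filter_congr fun b hb => ?_
    simp [lt_firstPart_of_mem (mem_boxes.1 hb).1]
  rw [hw, hw]
  obtain ⟨e1, e2⟩ := h.headWeight_benderKnuth (h.benderKnuth_full hk)
  by_cases h1 : m = k
  · rw [h1, Equiv.swap_apply_left, e1]
  · by_cases h2 : m = k + 1
    · rw [h2, Equiv.swap_apply_right, e2]
    · rw [Equiv.swap_apply_of_ne_of_ne h1 h2, headWeight_benderKnuth_of_ne h1 h2]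

theorem rename_prod_X_pow (e : Equiv.Perm (Fin n)) (α : Fin n → ℕ) :
    rename e (∏ i, (X i : MvPolynomial (Fin n) ℤ) ^ α i) = ∏ i, X i ^ α (e.symm i) := by
  rw [map_prod, ← Equiv.prod_comp e fun i => X i ^ α (e.symm i)]
  simp

/-- The Bender-Knuth involution on all columns is a bijection of the fillings that exchanges two
neighbouring content entries. -/
theorem rename_swap_skewSchur {a b : Fin n} (hab : (b : ℕ) = a + 1) :
    rename (Equiv.swap a b) (skewSchur S n) = skewSchur S n := by
  have hk : (a : ℕ) + 1 < n := hab ▸ b.2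
  rw [skewSchur_eq, map_sum]
  let g : ∀ F ∈ tableaux S n, boxes S → Fin n := fun F hF =>
    restrict S _ ((mem_tableaux.1 hF).benderKnuth_full hk).lt
  have hg : ∀ F hF, g F hF ∈ tableaux S n := fun F hF =>
    restrict_mem_tableaux ((mem_tableaux.1 hF).benderKnuth_full hk)
  have hgg : ∀ F hF, g (g F hF) (hg F hF) = F := fun F hF => by
    refine restrict_extend_eq _ fun i j hb => ?_
    rw [benderKnuth_congr (fun _ _ hb => extend_restrict hb) hb]
    exact (mem_tableaux.1 hF).benderKnuth_benderKnuth ((mem_tableaux.1 hF).benderKnuth_full hk) hb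
  refine Finset.sum_bij' g g hg hg hgg hgg fun F hF => ?_
  rw [rename_prod_X_pow]
  refine Finset.prod_congr rfl fun i _ => ?_
  congr 1
  rw [content_eq_weight, content_eq_weight, weight_congr (fun _ _ hb => extend_restrict hb),
    (mem_tableaux.1 hF).weight_benderKnuth_full hk]
  congr 1
  rw [Equiv.symm_swap, ← hab]
  simp only [Equiv.swap_apply_def, Fin.ext_iff]
  split_ifs <;> rfl

/-- Skew Schur polynomials are symmetric. -/
theorem isSymmetric_skewSchur : (skewSchur S n).IsSymmetric := by
  intro e
  -- The generation of the symmetric group by adjacent transpositions is available on `Fin (n + 1)`,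
  -- so the case without variables is separate.
  rcases n with _ | n
  · rw [Subsingleton.elim e 1]
    simp
  · have he : e ∈ Submonoid.closure (Set.range fun i : Fin n => Equiv.swap i.castSucc i.succ) := by
      rw [Equiv.Perm.mclosure_swap_castSucc_succ]
      trivial
    induction he using Submonoid.closure_induction with
    | mem x hx =>
      obtain ⟨i, rfl⟩ := hx
      exact rename_swap_skewSchur (by simp)
    | one => simp
    | mul x y _ _ hx hy =>
      rw [Equiv.Perm.coe_mul, ← rename_rename, hy, hx]

/-! ### The Littlewood-Richardson rule -/

open scoped Classical in
/-- The finset of all fillings that are Littlewood-Richardson tableaux. -/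
noncomputable def lrTableaux (S : SkewPartition) (n : ℕ) : Finset (boxes S → Fin n) :=
  Finset.univ.filter fun F => IsLR S n (extend S F)

theorem mem_lrTableaux {F : boxes S → Fin n} :
    F ∈ lrTableaux S n ↔ IsLR S n (extend S F) := by
  simp [lrTableaux]

theorem restrict_mem_lrTableaux {T : ℕ → ℕ → ℕ} (h : IsLR S n T) :
    restrict S T h.lt ∈ lrTableaux S n :=
  mem_lrTableaux.2 (h.congr fun _ _ hb => extend_restrict hb)

/-- In the term of the permutation `σ` the skew Schur polynomial, being symmetric, is rewritten with
its contents permuted by `σ`; then exponents add up inside the alternant. -/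
theorem alternant_mul_skewSchur_eq_sum_tableaux :
    alternant (staircase n) * skewSchur S n =
      ∑ F ∈ tableaux S n, alternant fun i => content S F i + staircase n i := by
  have h : ∀ σ : Equiv.Perm (Fin n), skewSchur S n =
      ∑ F ∈ tableaux S n, ∏ i, (X i : MvPolynomial (Fin n) ℤ) ^ content S F (σ i) := fun σ => by
    conv_lhs => rw [← isSymmetric_skewSchur σ.symm, skewSchur_eq, map_sum]
    simp only [rename_prod_X_pow, Equiv.symm_symm]
  simp only [alternant_eq_sum, Finset.sum_mul]
  rw [Finset.sum_comm]
  refine Finset.sum_congr rfl fun σ _ => ?_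
  rw [h σ, Finset.mul_sum]
  refine Finset.sum_congr rfl fun F _ => ?_
  rw [mul_assoc, ← Finset.prod_mul_distrib]
  simp only [← pow_add, add_comm]

theorem alternant_content_benderKnuth {T : ℕ → ℕ → ℕ} (hT : IsTableau S n T) {c k : ℕ}
    (h : IsCritical S T c k) :
    alternant (fun i : Fin n => weight S (benderKnuth S c k T) i + staircase n i) =
      -alternant fun i : Fin n => weight S T i + staircase n i := by
  have hk := h.lt_n hT
  let a : Fin n := ⟨k, by omega⟩
  let b : Fin n := ⟨k + 1, hk⟩
  have hab : a ≠ b := fun h => by simp [a, b, Fin.ext_iff] at h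
  rw [← alternant_comp_swap _ hab]
  congr 1
  funext i
  obtain ⟨e1, e2, e3⟩ := h.weight_benderKnuth hT
  have ha : (a : ℕ) = k := rfl
  have hb : (b : ℕ) = k + 1 := rfl
  by_cases h1 : i = a
  · subst h1
    simp only [Function.comp_apply, Equiv.swap_apply_left, staircase, ha, hb]
    omega
  · by_cases h2 : i = b
    · subst h2
      simp only [Function.comp_apply, Equiv.swap_apply_right, staircase, ha, hb]
      omega
    · simp only [Function.comp_apply, Equiv.swap_apply_of_ne_of_ne h1 h2]
      rw [e3 _ (fun h => h1 (Fin.ext h)) fun h => h2 (Fin.ext h)]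

/-- Stembridge's form of the Littlewood-Richardson rule. -/
theorem alternant_mul_skewSchur :
    alternant (staircase n) * skewSchur S n =
      ∑ F ∈ lrTableaux S n, alternant fun i => content S F i + staircase n i := by
  classical
  rw [alternant_mul_skewSchur_eq_sum_tableaux]
  have hsub : lrTableaux S n ⊆ tableaux S n := fun F hF =>
    mem_tableaux.2 (mem_lrTableaux.1 hF).toIsTableau
  rw [← Finset.sum_sdiff hsub, add_eq_right]
  have hcrit : ∀ F ∈ tableaux S n \ lrTableaux S n, ∃ p : ℕ × ℕ,
      IsCritical S (extend S F) p.1 p.2 := fun F hF => by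
    rw [Finset.mem_sdiff, mem_tableaux, mem_lrTableaux] at hF
    obtain ⟨c, k, h⟩ := exists_isCritical fun h => hF.2 ⟨hF.1, h⟩
    exact ⟨(c, k), h⟩
  choose! p hp using hcrit
  have hT : ∀ F ∈ tableaux S n \ lrTableaux S n, IsTableau S n (extend S F) := fun F hF =>
    mem_tableaux.1 (Finset.mem_sdiff.1 hF).1
  let g : ∀ F ∈ tableaux S n \ lrTableaux S n, boxes S → Fin n := fun F hF =>
    restrict S _ ((hp F hF).isTableau (hT F hF)).lt
  have hgc : ∀ F hF, IsCritical S (extend S (g F hF)) (p F).1 (p F).2 := fun F hF =>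
    (hp F hF).benderKnuth.congr fun _ _ hb => extend_restrict hb
  have hg : ∀ F hF, g F hF ∈ tableaux S n \ lrTableaux S n := fun F hF => by
    refine Finset.mem_sdiff.2
      ⟨restrict_mem_tableaux ((hp F hF).isTableau (hT F hF)), fun h => ?_⟩
    exact ((mem_lrTableaux.1 h).lattice _ _).not_gt (hgc F hF).lt
  have hsum : ∀ F hF, alternant (fun i => content S (g F hF) i + staircase n i) =
      -alternant fun i => content S F i + staircase n i := fun F hF => by
    simp only [content_eq_weight]
    rw [← alternant_content_benderKnuth (hT F hF) (hp F hF)]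
    simp only [g, weight_congr fun _ _ hb => extend_restrict hb]
  refine Finset.sum_involution g (fun F hF => ?_) (fun F hF hne he => ?_) hg fun F hF => ?_
  · rw [hsum F hF, add_neg_cancel]
  · have := hsum F hF
    rw [he] at this
    -- A fixed point has an alternant equal to its own negative, hence contributes zero.
    exact hne (self_eq_neg.1 this)
  · have hpe : p (g F hF) = p F :=
      Prod.ext ((hp _ (hg F hF)).unique (hgc F hF)).1 ((hp _ (hg F hF)).unique (hgc F hF)).2
    refine restrict_extend_eq _ fun i j hb => ?_
    rw [hpe, benderKnuth_congr (fun _ _ hb => extend_restrict hb) hb]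
    exact (hT F hF).benderKnuth_benderKnuth ((hp F hF).isTableau (hT F hF)) hb

end SkewSchur

namespace SkewSchur

open MvPolynomial

/-! ### Straight shapes -/

theorem mem_boxes_straight {nu : YoungDiagram} {b : ℕ × ℕ} : b ∈ boxes (straight nu) ↔ b ∈ nu := by
  rw [mem_boxes]
  exact and_iff_left (YoungDiagram.notMem_bot b)

theorem rowLen_eq_zero {nu : YoungDiagram} {i : ℕ} (h : len nu ≤ i) : nu.rowLen i = 0 := by
  by_contra hne
  have : (i, 0) ∈ nu := YoungDiagram.mem_iff_lt_rowLen.2 (Nat.pos_of_ne_zero hne)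
  have := lt_len_of_mem this
  omega

theorem colSet_straight (nu : YoungDiagram) (k : ℕ) :
    colSet (straight nu) (fun i _ => i) k = Finset.range (nu.rowLen k) := by
  ext j
  simp only [mem_colSet, mem_boxes_straight, Finset.mem_range, ← YoungDiagram.mem_iff_lt_rowLen]
  constructor
  · rintro ⟨i, h, rfl⟩
    exact h
  · exact fun h => ⟨k, h, rfl⟩

theorem isLR_straight {nu : YoungDiagram} {n : ℕ} (h : len nu ≤ n) :
    IsLR (straight nu) n fun i _ => i where
  lt i j hb := (lt_len_of_mem (mem_boxes_straight.1 hb)).trans_le h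
  row _ _ _ _ _ _ := le_rfl
  col _ _ _ _ _ h := h
  lattice j k := by
    rw [tailCount, tailCount, colSet_straight, colSet_straight]
    refine Finset.card_le_card (Finset.filter_subset_filter _ (Finset.range_subset_range.2 ?_))
    exact nu.rowLen_anti _ _ (Nat.le_succ k)

/-- Without an inner partition, the bound from the boxes above and the bound `le_row` meet. -/
theorem IsLR.eq_of_straight {nu : YoungDiagram} {n : ℕ} {T : ℕ → ℕ → ℕ}
    (h : IsLR (straight nu) n T) {i j : ℕ} (hb : (i, j) ∈ boxes (straight nu)) : T i j = i := by
  have h1 := h.le_row hb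
  have h2 := h.le_add_colLen hb
  have h3 : (straight nu).inner.colLen j = 0 := by
    by_contra hne
    exact YoungDiagram.notMem_bot _ (YoungDiagram.mem_iff_lt_colLen.2 (Nat.pos_of_ne_zero hne))
  omega

/-- The bialternant formula. -/
theorem alternant_mul_schur {nu : YoungDiagram} {n : ℕ} (h : len nu ≤ n) :
    alternant (staircase n) * schur nu n = alternant fun i => nu.rowLen i + staircase n i := by
  rw [schur, alternant_mul_skewSchur]
  have : lrTableaux (straight nu) n = {restrict (straight nu) _ (isLR_straight h).lt} := by
    refine Finset.eq_singleton_iff_unique_mem.2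
      ⟨restrict_mem_lrTableaux (isLR_straight h), fun F hF => ?_⟩
    rw [mem_lrTableaux] at hF
    exact (restrict_extend_eq _ fun i j hb => (hF.eq_of_straight hb).symm).symm
  rw [this, Finset.sum_singleton]
  congr 1
  funext i
  rw [content_eq_weight, weight_congr (fun _ _ hb => extend_restrict hb),
    (isLR_straight h).weight_eq, colSet_straight, Finset.card_range]

/-! ### The criterion for being multiplicity-free -/

theorem exists_rowLen_eq {f : ℕ → ℕ} (hf : Antitone f) {n : ℕ} (hn : f n = 0) :
    ∃ nu : YoungDiagram, ∀ i, nu.rowLen i = f i := by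
  have hlow : IsLowerSet (((Finset.range n ×ˢ Finset.range (f 0)).filter
      fun b => b.2 < f b.1 : Finset (ℕ × ℕ)) : Set (ℕ × ℕ)) := by
    rintro ⟨i, j⟩ ⟨i', j'⟩ ⟨h1, h2⟩ h
    simp only [Finset.mem_coe, Finset.mem_filter, Finset.mem_product, Finset.mem_range] at h h1 h2 ⊢
    have := hf h1
    omega
  refine ⟨⟨_, hlow⟩, fun i => ?_⟩
  have key : ∀ j, j < YoungDiagram.rowLen ⟨_, hlow⟩ i ↔ j < f i := fun j => by
    rw [← YoungDiagram.mem_iff_lt_rowLen, ← YoungDiagram.mem_cells]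
    simp only [Finset.mem_filter, Finset.mem_product, Finset.mem_range]
    refine ⟨And.right, fun h => ⟨⟨?_, h.trans_le (hf (Nat.zero_le i))⟩, h⟩⟩
    by_contra hle
    have := hf (not_lt.1 hle)
    omega
  exact eq_of_forall_lt_iff key

variable {S : SkewPartition} {n : ℕ}

theorem IsLR.exists_shape {T : ℕ → ℕ → ℕ} (h : IsLR S n T) :
    ∃ nu : YoungDiagram, len nu ≤ n ∧ ∀ i, nu.rowLen i = weight S T i := by
  have hanti : Antitone (weight S T) := antitone_nat_of_succ_le fun k => by
    rw [h.weight_eq, h.weight_eq, ← tailCount_zero, ← tailCount_zero]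
    exact h.lattice 0 k
  have hn : weight S T n = 0 := by
    rw [weight, Finset.card_eq_zero, Finset.filter_eq_empty_iff]
    exact fun b hb => (h.lt _ _ hb).ne
  obtain ⟨nu, hnu⟩ := exists_rowLen_eq hanti hn
  refine ⟨nu, ?_, hnu⟩
  by_contra hlt
  rw [not_le, lt_len_iff, YoungDiagram.mem_iff_lt_rowLen, hnu, hn] at hlt
  exact lt_irrefl 0 hlt

theorem strictAnti_rowLen_add_staircase (nu : YoungDiagram) (n : ℕ) :
    StrictAnti fun i : Fin n => nu.rowLen i + staircase n i := fun i j hij => by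
  have h1 := nu.rowLen_anti i j hij.le
  have h2 := staircase_strictAnti n hij
  simp only
  omega

theorem eq_of_rowLen_eq {nu nu' : YoungDiagram} (h : len nu ≤ n) (h' : len nu' ≤ n)
    (he : ∀ i : Fin n, nu.rowLen i = nu'.rowLen i) : nu = nu' := by
  have : ∀ i, nu.rowLen i = nu'.rowLen i := fun i => by
    rcases lt_or_ge i n with hi | hi
    · exact he ⟨i, hi⟩
    · rw [rowLen_eq_zero (h.trans hi), rowLen_eq_zero (h'.trans hi)]
  ext ⟨i, j⟩
  rw [YoungDiagram.mem_cells, YoungDiagram.mem_cells, YoungDiagram.mem_iff_lt_rowLen,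
    YoungDiagram.mem_iff_lt_rowLen, this]

theorem coeff_alternant_rowLen {nu nu' : YoungDiagram} [Decidable (nu' = nu)] (h : len nu ≤ n) (h' : len nu' ≤ n) :
    coeff (Finsupp.equivFunOnFinite.symm fun i : Fin n => nu.rowLen i + staircase n i)
      (alternant fun i : Fin n => nu'.rowLen i + staircase n i) = if nu' = nu then 1 else 0 := by
  rw [coeff_alternant (strictAnti_rowLen_add_staircase nu' n) (strictAnti_rowLen_add_staircase nu n)]
  refine if_congr ⟨fun he => ?_, ?_⟩ rfl rfl
  · exact eq_of_rowLen_eq h' h fun i => Nat.add_right_cancel (congrFun he i)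
  · rintro rfl
    rfl

/-- The skew Schur polynomial is multiplicity-free iff Littlewood-Richardson tableaux with equal
content are equal. -/
theorem multiplicityFree_iff_lrTableaux : MultiplicityFree S n ↔
    ∀ F ∈ lrTableaux S n, ∀ F' ∈ lrTableaux S n,
      (∀ i, content S F i = content S F' i) → F = F' := by
  classical
  have hshape : ∀ F ∈ lrTableaux S n, ∃ nu : YoungDiagram, len nu ≤ n ∧
      ∀ i : Fin n, nu.rowLen i = content S F i := fun F hF => by
    obtain ⟨nu, h1, h2⟩ := (mem_lrTableaux.1 hF).exists_shape
    exact ⟨nu, h1, fun i => by rw [h2, content_eq_weight]⟩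
  choose! shape hlen hrow using hshape
  have hrule : alternant (staircase n) * skewSchur S n = ∑ F ∈ lrTableaux S n,
      alternant fun i : Fin n => (shape F).rowLen i + staircase n i := by
    rw [alternant_mul_skewSchur]
    refine Finset.sum_congr rfl fun F hF => ?_
    simp only [hrow F hF]
  constructor
  · rintro ⟨c, ⟨hc, he⟩, h01⟩ F hF F' hF' hcont
    by_contra hne
    have hs : shape F = shape F' := eq_of_rowLen_eq (hlen F hF) (hlen F' hF') fun i => by
      rw [hrow F hF, hrow F' hF', hcont]
    -- The same coefficient is computed twice: from the given expansion it is an entry of `c`, and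
    -- from the Littlewood-Richardson rule it is the number of tableaux of this content, at least
    -- two here.
    have h1 : coeff (Finsupp.equivFunOnFinite.symm
        fun i : Fin n => (shape F).rowLen i + staircase n i)
        (alternant (staircase n) * skewSchur S n) = c (shape F) := by
      rw [he, Finsupp.sum, Finset.mul_sum, coeff_sum]
      have : ∀ nu ∈ c.support, coeff (Finsupp.equivFunOnFinite.symm
          fun i : Fin n => (shape F).rowLen i + staircase n i)
          (alternant (staircase n) * (C (c nu) * schur nu n)) =
          if nu = shape F then c nu else 0 := fun nu hnu => by
        have hl : len nu ≤ n := by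
          by_contra hlt
          exact Finsupp.mem_support_iff.1 hnu (hc nu (not_le.1 hlt))
        rw [mul_left_comm, alternant_mul_schur hl, coeff_C_mul,
          coeff_alternant_rowLen (hlen F hF) hl, mul_ite, mul_one, mul_zero]
      rw [Finset.sum_congr rfl this, Finset.sum_ite_eq']
      split_ifs with h
      · rfl
      · exact (Finsupp.notMem_support_iff.1 h).symm
    have h2 : (2 : ℤ) ≤ coeff (Finsupp.equivFunOnFinite.symm
        fun i : Fin n => (shape F).rowLen i + staircase n i)
        (alternant (staircase n) * skewSchur S n) := by
      rw [hrule, coeff_sum, Finset.sum_congr rfl fun F' hF' =>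
        coeff_alternant_rowLen (hlen F hF) (hlen F' hF'), Finset.sum_boole]
      have hsub : ({F, F'} : Finset _) ⊆
          (lrTableaux S n).filter fun G => shape G = shape F := by
        intro G hG
        rw [Finset.mem_insert, Finset.mem_singleton] at hG
        rcases hG with rfl | rfl
        · exact Finset.mem_filter.2 ⟨hF, rfl⟩
        · exact Finset.mem_filter.2 ⟨hF', hs.symm⟩
      have := Finset.card_le_card hsub
      rw [Finset.card_pair hne] at this
      exact_mod_cast this
    rw [h1] at h2
    rcases h01 (shape F) with h | h <;> omega
  · intro hinj
    -- The coefficients count tableaux by shape. The expansion is verified after multiplication by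
    -- the nonzero staircase alternant.
    refine ⟨∑ F ∈ lrTableaux S n, Finsupp.single (shape F) 1, ⟨fun nu hnu => ?_, ?_⟩, fun nu => ?_⟩
    · rw [Finsupp.finsetSum_apply]
      refine Finset.sum_eq_zero fun F hF => Finsupp.single_eq_of_ne ?_
      rintro rfl
      exact absurd (hlen F hF) (not_le.2 hnu)
    · rw [← Finsupp.sum_finsetSum_index (by simp) (by simp [add_mul])]
      apply mul_left_cancel₀ (alternant_staircase_ne_zero n)
      rw [hrule, Finset.mul_sum]
      refine Finset.sum_congr rfl fun F hF => ?_
      rw [Finsupp.sum_single_index (by simp), C_1, one_mul, alternant_mul_schur (hlen F hF)]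
    · rw [Finsupp.finsetSum_apply]
      by_cases h : ∃ F ∈ lrTableaux S n, shape F = nu
      · obtain ⟨F, hF, rfl⟩ := h
        right
        rw [Finset.sum_eq_single_of_mem F hF]
        · simp
        · intro F' hF' hne
          refine Finsupp.single_eq_of_ne fun he => hne (hinj _ hF' _ hF fun i => ?_)
          rw [← hrow F hF, ← hrow F' hF', he]
      · left
        refine Finset.sum_eq_zero fun F hF => Finsupp.single_eq_of_ne fun he => ?_
        exact h ⟨F, hF, he.symm⟩

theorem multiplicityFree_iff : MultiplicityFree S n ↔
    ∀ T T', IsLR S n T → IsLR S n T' → (∀ k < n, (colSet S T k).card = (colSet S T' k).card) →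
      ∀ i j, (i, j) ∈ boxes S → T i j = T' i j := by
  rw [multiplicityFree_iff_lrTableaux]
  constructor
  · intro h T T' hT hT' hw i j hb
    have := h _ (restrict_mem_lrTableaux hT) _ (restrict_mem_lrTableaux hT') fun k => by
      rw [content_eq_weight, content_eq_weight, weight_congr fun _ _ hb => extend_restrict hb,
        weight_congr fun _ _ hb => extend_restrict hb, hT.weight_eq, hT'.weight_eq, hw k k.2]
    rw [← extend_restrict (h := hT.lt) hb, this, extend_restrict hb]
  · intro h F hF F' hF' hc
    rw [mem_lrTableaux] at hF hF'
    funext ⟨⟨i, j⟩, hb⟩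
    have := h _ _ hF hF' (fun k hk => by
      have := hc ⟨k, hk⟩
      rwa [content_eq_weight, content_eq_weight, hF.weight_eq, hF'.weight_eq] at this) i j hb
    rw [extend_of_mem hb, extend_of_mem hb] at this
    exact Fin.ext this

end SkewSchur

/-! ### Operations on shapes that preserve multiplicity-freeness -/

namespace SkewSchur

/-! ### Transfer of multiplicity-freeness -/

variable {S S' : SkewPartition} {n n' : ℕ}

/-- A correspondence between Littlewood-Richardson tableaux that respects equality of tableaux and
equality of contents transfers multiplicity-freeness. -/
theorem multiplicityFree_congr (f : (ℕ → ℕ → ℕ) → ℕ → ℕ → ℕ)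
    (hf : ∀ T, IsLR S n T → IsLR S' n' (f T))
    (hsurj : ∀ T', IsLR S' n' T' → ∃ T, IsLR S n T ∧ ∀ i j, (i, j) ∈ boxes S' → f T i j = T' i j)
    (hw : ∀ T₁ T₂, IsLR S n T₁ → IsLR S n T₂ →
      ((∀ k < n, (colSet S T₁ k).card = (colSet S T₂ k).card) ↔
        ∀ k < n', (colSet S' (f T₁) k).card = (colSet S' (f T₂) k).card))
    (hinj : ∀ T₁ T₂, IsLR S n T₁ → IsLR S n T₂ →
      ((∀ i j, (i, j) ∈ boxes S → T₁ i j = T₂ i j) ↔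
        ∀ i j, (i, j) ∈ boxes S' → f T₁ i j = f T₂ i j)) :
    MultiplicityFree S n ↔ MultiplicityFree S' n' := by
  rw [multiplicityFree_iff, multiplicityFree_iff]
  constructor
  · intro h T₁' T₂' h₁' h₂' hc i j hb
    obtain ⟨T₁, h₁, e₁⟩ := hsurj T₁' h₁'
    obtain ⟨T₂, h₂, e₂⟩ := hsurj T₂' h₂'
    rw [← e₁ i j hb, ← e₂ i j hb]
    refine (hinj T₁ T₂ h₁ h₂).1 (h T₁ T₂ h₁ h₂ ((hw T₁ T₂ h₁ h₂).2 fun k hk => ?_)) i j hb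
    rw [colSet_congr e₁, colSet_congr e₂, hc k hk]
  · intro h T₁ T₂ h₁ h₂ hc
    exact (hinj T₁ T₂ h₁ h₂).2 (h _ _ (hf _ h₁) (hf _ h₂) ((hw T₁ T₂ h₁ h₂).1 hc))

theorem mem_boxes_iff_colLen {i j : ℕ} :
    (i, j) ∈ boxes S ↔ S.inner.colLen j ≤ i ∧ i < S.outer.colLen j := by
  rw [mem_boxes, YoungDiagram.mem_iff_lt_colLen, YoungDiagram.mem_iff_lt_colLen, not_lt, and_comm]

theorem mem_boxes_iff_rowLen {i j : ℕ} :
    (i, j) ∈ boxes S ↔ S.inner.rowLen i ≤ j ∧ j < S.outer.rowLen i := by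
  rw [mem_boxes, YoungDiagram.mem_iff_lt_rowLen, YoungDiagram.mem_iff_lt_rowLen, not_lt, and_comm]

theorem tailCount_eq_zero {T : ℕ → ℕ → ℕ} (h : IsTableau S n T) {j k : ℕ} (hk : n ≤ k) :
    tailCount S T j k = 0 := by
  rw [tailCount, Finset.card_eq_zero, Finset.filter_eq_empty_iff]
  intro a ha
  obtain ⟨i, hb, he⟩ := mem_colSet.1 ha
  have := h.lt _ _ hb
  omega

/-- Part of the outer partition is cut off. -/
def trimmed (S : SkewPartition) (t s : ℕ) (h : S.inner ≤ trim t s S.outer) : SkewPartition :=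
  ⟨trim t s S.outer, S.inner, h⟩

theorem mem_boxes_trimmed {t s : ℕ} {h : S.inner ≤ trim t s S.outer} {i j : ℕ} :
    (i, j) ∈ boxes (trimmed S t s h) ↔ (i + t, j + s) ∈ S.outer ∧ (i, j) ∉ S.inner := by
  rw [mem_boxes, ← mem_trim]
  rfl

theorem colLen_le_len (lam : YoungDiagram) (j : ℕ) : lam.colLen j ≤ len lam :=
  lam.colLen_anti 0 j (Nat.zero_le j)

theorem rowLen_le_firstPart (lam : YoungDiagram) (i : ℕ) : lam.rowLen i ≤ firstPart lam :=
  lam.rowLen_anti 0 i (Nat.zero_le i)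

/-! ### Omission of full rows -/

section OmitRows

variable {t : ℕ} {h : S.inner ≤ trim t 0 S.outer} {T : ℕ → ℕ → ℕ}

/-- The entries in the long rows of the outer partition are as small as possible. -/
def IsTopMinimal (S : SkewPartition) (t : ℕ) (T : ℕ → ℕ → ℕ) : Prop :=
  ∀ i < len S.inner + t, ∀ j, (i, j) ∈ boxes S → T i j + S.inner.colLen j = i

/-- Trimming `t` rows while keeping the inner partition amounts to removing the top `t` boxes of
each column of the skew diagram and moving the rest up by `t`. -/
theorem boxes_of_mem_boxes_trimmed {i j : ℕ} (hb : (i, j) ∈ boxes (trimmed S t 0 h)) :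
    (i + t, j) ∈ boxes S ∧ S.inner.colLen j ≤ i := by
  rw [mem_boxes_trimmed, YoungDiagram.mem_iff_lt_colLen, YoungDiagram.mem_iff_lt_colLen] at hb
  rw [mem_boxes_iff_colLen]
  rw [Nat.add_zero] at hb
  omega

theorem boxes_trimmed_of_mem_boxes {i j : ℕ} (hb : (i + t, j) ∈ boxes S)
    (hi : S.inner.colLen j ≤ i) : (i, j) ∈ boxes (trimmed S t 0 h) := by
  rw [mem_boxes_trimmed]
  refine ⟨(mem_boxes.1 hb).1, fun hm => ?_⟩
  rw [YoungDiagram.mem_iff_lt_colLen] at hm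
  omega

theorem colSet_of_lt (htop : ∀ i < len S.inner + t, S.outer.rowLen i = firstPart S.outer)
    (hT : IsTopMinimal S t T) {k : ℕ} (hk : k < t) :
    colSet S T k = Finset.range (firstPart S.outer) := by
  ext j
  rw [mem_colSet, Finset.mem_range]
  constructor
  · rintro ⟨i, hb, -⟩
    exact lt_firstPart_of_mem (mem_boxes.1 hb).1
  · intro hj
    have hlen := colLen_le_len S.inner j
    have hi : k + S.inner.colLen j < len S.inner + t := by omega
    have hb : (k + S.inner.colLen j, j) ∈ boxes S := by
      rw [mem_boxes, YoungDiagram.mem_iff_lt_rowLen, htop _ hi, YoungDiagram.mem_iff_lt_colLen]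
      exact ⟨hj, by omega⟩
    exact ⟨_, hb, by have := hT _ hi j hb; omega⟩

/-- Entries at least `t` lie below the top `t` boxes of their column: within the long rows by
minimality, and farther down because the row index is large enough. -/
theorem colSet_add (hT : IsTableau S n T) (hm : IsTopMinimal S t T) (k : ℕ) :
    colSet S T (k + t) = colSet (trimmed S t 0 h) (fun i j => T (i + t) j - t) k := by
  ext j
  simp only [mem_colSet]
  constructor
  · rintro ⟨i, hb, he⟩
    have hlen := colLen_le_len S.inner j
    have hi : S.inner.colLen j + t ≤ i := by
      by_cases hi : i < len S.inner + t
      · have := hm i hi j hb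
        omega
      · omega
    obtain ⟨i, rfl⟩ : ∃ i', i = i' + t := ⟨i - t, by omega⟩
    exact ⟨i, boxes_trimmed_of_mem_boxes hb (by omega), by omega⟩
  · rintro ⟨i, hb, he⟩
    obtain ⟨hb', hi⟩ := boxes_of_mem_boxes_trimmed hb
    have := hT.le_add_colLen hb'
    exact ⟨i + t, hb', by omega⟩

theorem IsLR.isTopMinimal (htop : ∀ i < len S.inner + t, S.outer.rowLen i = firstPart S.outer)
    (hT : IsLR S n T) : IsTopMinimal S t T := fun _ hi _ hb =>
  hT.eq_of_top_rectangle htop hi hb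

theorem isLR_iff_omitRows (htop : ∀ i < len S.inner + t, S.outer.rowLen i = firstPart S.outer)
    (hT : IsTableau S n T) (hm : IsTopMinimal S t T) :
    IsLR S n T ↔ IsLR (trimmed S t 0 h) (n - t) fun i j => T (i + t) j - t := by
  have hge : ∀ i j, (i, j) ∈ boxes (trimmed S t 0 h) → (i + t, j) ∈ boxes S ∧ t ≤ T (i + t) j :=
    fun i j hb => by
      obtain ⟨hb', hi⟩ := boxes_of_mem_boxes_trimmed hb
      have := hT.le_add_colLen hb'
      exact ⟨hb', by omega⟩
  constructor
  · intro hL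
    refine ⟨⟨fun i j hb => ?_, fun i j j' hb hb' hj => ?_, fun i i' j hb hb' hi => ?_⟩,
      fun j k => ?_⟩
    · have := hge i j hb
      have := hT.lt _ _ this.1
      omega
    · have := hT.row _ _ _ (hge i j hb).1 (hge i j' hb').1 hj
      omega
    · have := hT.col _ _ _ (hge i j hb).1 (hge i' j hb').1 (Nat.add_lt_add_right hi t)
      have := hge i j hb
      omega
    · have := hL.lattice j (k + t)
      rwa [tailCount, tailCount, Nat.add_right_comm, colSet_add hT hm, colSet_add hT hm] at this
  · intro hL
    refine ⟨hT, fun j k => ?_⟩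
    rcases lt_or_ge k t with hk | hk
    · rw [tailCount, tailCount, colSet_of_lt htop hm hk]
      refine Finset.card_le_card (Finset.filter_subset_filter _ fun j hj => ?_)
      obtain ⟨i, hb, -⟩ := mem_colSet.1 hj
      exact Finset.mem_range.2 (lt_firstPart_of_mem (mem_boxes.1 hb).1)
    · obtain ⟨k, rfl⟩ : ∃ k', k = k' + t := ⟨k - t, by omega⟩
      have := hL.lattice j k
      rwa [tailCount, tailCount, Nat.add_right_comm, colSet_add (h := h) hT hm,
        colSet_add (h := h) hT hm]

/-- Full rows may be omitted, together with as many variables. -/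
theorem multiplicityFree_omitRows (ht : t ≤ n)
    (htop : ∀ i < len S.inner + t, S.outer.rowLen i = firstPart S.outer) :
    MultiplicityFree S n ↔ MultiplicityFree (trimmed S t 0 h) (n - t) := by
  have hge : ∀ T, IsLR S n T → ∀ i j, (i, j) ∈ boxes (trimmed S t 0 h) →
      (i + t, j) ∈ boxes S ∧ t ≤ T (i + t) j := fun T hT i j hb => by
    obtain ⟨hb', hi⟩ := boxes_of_mem_boxes_trimmed hb
    have := hT.le_add_colLen hb'
    exact ⟨hb', by omega⟩
  refine multiplicityFree_congr (fun T i j => T (i + t) j - t)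
    (fun T hT => (isLR_iff_omitRows htop hT.toIsTableau (hT.isTopMinimal htop)).1 hT) ?_ ?_ ?_
  · intro T' hT'
    -- The preimage: the top `t` boxes of a column receive `0, ..., t - 1`, and `T'` follows below,
    -- shifted by `t`.
    let T : ℕ → ℕ → ℕ := fun i j =>
      if i < S.inner.colLen j + t then i - S.inner.colLen j else T' (i - t) j + t
    have hlow : ∀ i j, i < S.inner.colLen j + t → T i j = i - S.inner.colLen j :=
      fun i j hi => if_pos hi
    have hhigh : ∀ i j, S.inner.colLen j + t ≤ i → T i j = T' (i - t) j + t :=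
      fun i j hi => if_neg (not_lt.2 hi)
    have hbox : ∀ i j, (i, j) ∈ boxes S → S.inner.colLen j + t ≤ i →
        (i - t, j) ∈ boxes (trimmed S t 0 h) := fun i j hb hi =>
      boxes_trimmed_of_mem_boxes (by rwa [Nat.sub_add_cancel (by omega)]) (by omega)
    have hbound : ∀ i j, (i, j) ∈ boxes S → S.inner.colLen j + t ≤ i →
        i ≤ T' (i - t) j + t + S.inner.colLen j := fun i j hb hi => by
      have := hT'.le_add_colLen (hbox i j hb hi)
      change i - t ≤ T' (i - t) j + S.inner.colLen j at this
      omega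
    have hTab : IsTableau S n T := by
      refine ⟨fun i j hb => ?_, fun i j j' hb hb' hj => ?_, fun i i' j hb hb' hi => ?_⟩
      · rcases lt_or_ge i (S.inner.colLen j + t) with hi | hi
        · rw [hlow i j hi]
          have := mem_boxes_iff_colLen.1 hb
          omega
        · rw [hhigh i j hi]
          have := hT'.lt _ _ (hbox i j hb hi)
          omega
      · have hanti := S.inner.colLen_anti j j' hj.le
        rcases lt_or_ge i (S.inner.colLen j + t) with hi | hi
        · rw [hlow i j hi]
          rcases lt_or_ge i (S.inner.colLen j' + t) with hi' | hi'
          · rw [hlow i j' hi']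
            omega
          · rw [hhigh i j' hi']
            have := hbound i j' hb' hi'
            omega
        · rw [hhigh i j hi, hhigh i j' (by omega)]
          have := hT'.row _ _ _ (hbox i j hb hi) (hbox i j' hb' (by omega)) hj
          omega
      · rcases lt_or_ge i (S.inner.colLen j + t) with hlt | hge
        · rw [hlow i j hlt]
          have := (mem_boxes_iff_colLen.1 hb).1
          rcases lt_or_ge i' (S.inner.colLen j + t) with hi' | hi'
          · rw [hlow i' j hi']
            omega
          · rw [hhigh i' j hi']
            omega
        · rw [hhigh i j hge, hhigh i' j (by omega)]
          have := hT'.col _ _ _ (hbox i j hb hge) (hbox i' j hb' (by omega)) (by omega)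
          omega
    -- The trimmed shape still has a top rectangle as high as the inner partition, so `T'` is
    -- minimal there and `T` is minimal in all the long rows.
    have htop' : ∀ i < len S.inner, (trimmed S t 0 h).outer.rowLen i =
        firstPart (trimmed S t 0 h).outer := by
      have : ∀ i < len S.inner, (trimmed S t 0 h).outer.rowLen i = firstPart S.outer :=
        fun i hi => by
          rw [← htop (i + t) (by omega)]
          refine eq_of_forall_lt_iff fun j => ?_
          rw [← YoungDiagram.mem_iff_lt_rowLen, ← YoungDiagram.mem_iff_lt_rowLen]
          exact mem_trim
      intro i hi
      exact (this i hi).trans (this 0 (by omega)).symm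
    have hmin : ∀ i j, (i, j) ∈ boxes (trimmed S t 0 h) → i < len S.inner →
        T' i j + S.inner.colLen j = i := fun i j hb hi => hT'.eq_of_top_rectangle htop' hi hb
    have hm : IsTopMinimal S t T := fun i hi j hb => by
      have := (mem_boxes_iff_colLen.1 hb).1
      rcases lt_or_ge i (S.inner.colLen j + t) with hlt | hge
      · rw [hlow i j hlt]
        omega
      · rw [hhigh i j hge]
        have := hmin _ _ (hbox i j hb hge) (by omega)
        omega
    have he : ∀ i j, (i, j) ∈ boxes (trimmed S t 0 h) → T (i + t) j - t = T' i j :=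
      fun i j hb => by
        have := (boxes_of_mem_boxes_trimmed hb).2
        rw [hhigh (i + t) j (by omega), Nat.add_sub_cancel, Nat.add_sub_cancel]
    exact ⟨T, (isLR_iff_omitRows htop hTab hm).2 (hT'.congr he), he⟩
  · intro T₁ T₂ h₁ h₂
    have m₁ := h₁.isTopMinimal htop
    have m₂ := h₂.isTopMinimal htop
    constructor
    · intro hw k hk
      have := hw (k + t) (by omega)
      rwa [colSet_add h₁.toIsTableau m₁, colSet_add h₂.toIsTableau m₂] at this
    · intro hw k hk
      rcases lt_or_ge k t with hkt | hkt
      · rw [colSet_of_lt htop m₁ hkt, colSet_of_lt htop m₂ hkt]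
      · have := hw (k - t) (by omega)
        rwa [← colSet_add h₁.toIsTableau m₁, ← colSet_add h₂.toIsTableau m₂,
          Nat.sub_add_cancel hkt] at this
  · intro T₁ T₂ h₁ h₂
    constructor
    · intro he i j hb
      simp only [he _ _ (hge T₁ h₁ i j hb).1]
    · intro he i j hb
      by_cases hi : i < len S.inner + t
      · have e₁ := h₁.isTopMinimal htop i hi j hb
        have e₂ := h₂.isTopMinimal htop i hi j hb
        omega
      · have hlen := colLen_le_len S.inner j
        obtain ⟨i, rfl⟩ : ∃ i', i = i' + t := ⟨i - t, by omega⟩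
        have hb' : (i, j) ∈ boxes (trimmed S t 0 h) := boxes_trimmed_of_mem_boxes hb (by omega)
        have := he i j hb'
        have := (hge T₁ h₁ i j hb').2
        have := (hge T₂ h₂ i j hb').2
        omega

end OmitRows

end SkewSchur

namespace SkewSchur

variable {S : SkewPartition} {n : ℕ}

/-! ### Omission of full columns -/

section OmitColumns

variable {s : ℕ} {h : S.inner ≤ trim 0 s S.outer} {T : ℕ → ℕ → ℕ}

theorem tailCount_eq_card_add {m j k : ℕ} (hj : j ≤ m) : tailCount S T j k =
    ((colSet S T k).filter fun a => j ≤ a ∧ a < m).card + tailCount S T m k := by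
  rw [tailCount, tailCount, ← Finset.card_union_of_disjoint]
  · congr 1
    ext a
    simp only [Finset.mem_filter, Finset.mem_union]
    by_cases ha : a ∈ colSet S T k
    · simp only [ha, true_and]
      omega
    · simp [ha]
  · rw [Finset.disjoint_filter]
    intro a _ h1 h2
    omega

theorem colLen_inner_eq_zero {j : ℕ} (hj : firstPart S.inner ≤ j) : S.inner.colLen j = 0 := by
  by_contra hne
  have := YoungDiagram.mem_iff_lt_colLen.2 (Nat.pos_of_ne_zero hne)
  have := lt_firstPart_iff.2 this
  omega

/-- To the right of the inner partition the shape is straight; entry `k` then fills the part of row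
`k` from column `j` on. -/
theorem tailCount_of_rigid
    (hT : ∀ i j, (i, j) ∈ boxes S → firstPart S.inner ≤ j → T i j = i) {j : ℕ} (k : ℕ)
    (hj : firstPart S.inner ≤ j) : tailCount S T j k = S.outer.rowLen k - j := by
  have : (colSet S T k).filter (j ≤ ·) = Finset.Ico j (S.outer.rowLen k) := by
    ext a
    rw [Finset.mem_filter, mem_colSet, Finset.mem_Ico, and_comm, and_congr_right_iff]
    intro ha
    rw [← YoungDiagram.mem_iff_lt_rowLen]
    constructor
    · rintro ⟨i, hb, he⟩
      rw [hT i a hb (hj.trans ha)] at he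
      exact he ▸ (mem_boxes.1 hb).1
    · intro hm
      have hb : (k, a) ∈ boxes S := mem_boxes.2 ⟨hm, fun h' => by
        have := lt_firstPart_of_mem h'
        omega⟩
      exact ⟨k, hb, hT k a hb (hj.trans ha)⟩
  rw [tailCount, this, Nat.card_Ico]

theorem IsLR.eq_row (hT : IsLR S n T) {i j : ℕ} (hb : (i, j) ∈ boxes S)
    (hj : firstPart S.inner ≤ j) : T i j = i := by
  have h1 := hT.le_row hb
  have h2 := hT.le_add_colLen hb
  rw [colLen_inner_eq_zero hj] at h2
  omega

theorem rowLen_trimmed (i : ℕ) :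
    (trimmed S 0 s h).outer.rowLen i = S.outer.rowLen i - s := by
  refine eq_of_forall_lt_iff fun j => ?_
  rw [← YoungDiagram.mem_iff_lt_rowLen, Nat.lt_sub_iff_add_lt, ← YoungDiagram.mem_iff_lt_rowLen]
  exact mem_trim

theorem boxes_trimmed_iff (hrow : ∀ i < len S.outer, firstPart S.inner + s ≤ S.outer.rowLen i)
    {i j : ℕ} (hj : j < firstPart S.inner) :
    (i, j) ∈ boxes (trimmed S 0 s h) ↔ (i, j) ∈ boxes S := by
  rw [mem_boxes_trimmed, mem_boxes]
  refine and_congr_left fun _ => ⟨S.outer.up_left_mem le_rfl (Nat.le_add_right _ _), fun hm => ?_⟩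
  have := hrow i (lt_len_of_mem hm)
  exact YoungDiagram.mem_iff_lt_rowLen.2 (by rw [Nat.add_zero]; omega)

/-- The entries of the columns that the inner partition does not meet are replaced by the numbers
of their rows. -/
def rigidify (m : ℕ) (T : ℕ → ℕ → ℕ) (i j : ℕ) : ℕ := if j < m then T i j else i

theorem IsTableau.rigidify {S' : SkewPartition} (hT : IsTableau S n T)
    (hle : ∀ i j, (i, j) ∈ boxes S → T i j ≤ i) (hn : len S'.outer ≤ n)
    (hb : ∀ i j, j < firstPart S.inner → ((i, j) ∈ boxes S' ↔ (i, j) ∈ boxes S)) :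
    IsTableau S' n (rigidify (firstPart S.inner) T) := by
  unfold SkewSchur.rigidify
  refine ⟨fun i j h => ?_, fun i j j' h h' hj => ?_, fun i i' j h h' hi => ?_⟩
  · split_ifs with hj
    · exact hT.lt _ _ ((hb i j hj).1 h)
    · exact (lt_len_of_mem (mem_boxes.1 h).1).trans_le hn
  · by_cases h1 : j < firstPart S.inner
    · by_cases h2 : j' < firstPart S.inner
      · rw [if_pos h1, if_pos h2]
        exact hT.row _ _ _ ((hb i j h1).1 h) ((hb i j' h2).1 h') hj
      · rw [if_pos h1, if_neg h2]
        exact hle _ _ ((hb i j h1).1 h)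
    · rw [if_neg h1, if_neg (by omega)]
  · split_ifs with h1
    · exact hT.col _ _ _ ((hb i j h1).1 h) ((hb i' j h1).1 h') hi
    · exact hi

theorem colSet_filter_rigidify {S' : SkewPartition}
    (hb : ∀ i j, j < firstPart S.inner → ((i, j) ∈ boxes S' ↔ (i, j) ∈ boxes S)) (j k : ℕ) :
    ((colSet S' (rigidify (firstPart S.inner) T) k).filter
      fun a => j ≤ a ∧ a < firstPart S.inner) =
    (colSet S T k).filter fun a => j ≤ a ∧ a < firstPart S.inner := by
  ext a
  simp only [Finset.mem_filter, mem_colSet]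
  refine and_congr_left fun ha => exists_congr fun i => ?_
  rw [hb i a ha.2, rigidify, if_pos ha.2]

theorem tailCount_rigidify
    (hrow : ∀ i < len S.outer, firstPart S.inner + s ≤ S.outer.rowLen i)
    (hT : ∀ i j, (i, j) ∈ boxes S → firstPart S.inner ≤ j → T i j = i)
    {j : ℕ} (hj : j ≤ firstPart S.inner) (k : ℕ) :
    tailCount S T j k =
      tailCount (trimmed S 0 s h) (rigidify (firstPart S.inner) T) j k +
        if k < len S.outer then s else 0 := by
  have hT' : ∀ i j, (i, j) ∈ boxes (trimmed S 0 s h) →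
      firstPart (trimmed S 0 s h).inner ≤ j → rigidify (firstPart S.inner) T i j = i :=
    fun i j _ hj => if_neg (not_lt.2 hj)
  rw [tailCount_eq_card_add hj, tailCount_eq_card_add hj,
    colSet_filter_rigidify fun i j hj => boxes_trimmed_iff hrow hj,
    tailCount_of_rigid hT k le_rfl,
    tailCount_of_rigid hT' k (le_refl (firstPart S.inner)), rowLen_trimmed]
  split_ifs with hk
  · have := hrow k hk
    omega
  · rw [rowLen_eq_zero (not_lt.1 hk)]
    omega

/-- The omitted columns contain each entry below `len S.outer` once. The lattice inequalities
therefore shift equally on both sides, except where `k + 1` reaches `len S.outer`. -/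
theorem isLR_iff_rigidify
    (hrow : ∀ i < len S.outer, firstPart S.inner + s ≤ S.outer.rowLen i)
    (hT : IsTableau S n T) (hrigid : ∀ i j, (i, j) ∈ boxes S → firstPart S.inner ≤ j → T i j = i)
    (hle : ∀ i j, (i, j) ∈ boxes S → T i j ≤ i)
    (hT' : IsTableau (trimmed S 0 s h) n (rigidify (firstPart S.inner) T)) :
    IsLR S n T ↔ IsLR (trimmed S 0 s h) n (rigidify (firstPart S.inner) T) := by
  have hrigid' : ∀ i j, (i, j) ∈ boxes (trimmed S 0 s h) →
      firstPart (trimmed S 0 s h).inner ≤ j → rigidify (firstPart S.inner) T i j = i :=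
    fun i j _ hj => if_neg (not_lt.2 hj)
  have hzero : ∀ j k, len S.outer ≤ k → tailCount S T j k = 0 := fun j k hk => by
    rw [tailCount, Finset.card_eq_zero, Finset.filter_eq_empty_iff]
    intro a ha
    obtain ⟨i, hb, he⟩ := mem_colSet.1 ha
    have := hle i a hb
    have := lt_len_of_mem (mem_boxes.1 hb).1
    omega
  constructor
  · refine fun hL => ⟨hT', fun j k => ?_⟩
    rcases le_total j (firstPart S.inner) with hj | hj
    · have h1 := hL.lattice j k
      -- When `k + 1` is no longer a row number, only the smaller count may lack the summand `s`;
      -- but no entry exceeds its row index, so that count is zero.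
      have h2 := hzero j (k + 1)
      rw [tailCount_rigidify (h := h) hrow hrigid hj] at h1 h2
      rw [tailCount_rigidify (h := h) hrow hrigid hj] at h1
      split_ifs at h1 h2 <;> omega
    · rw [tailCount_of_rigid hrigid' _ hj, tailCount_of_rigid hrigid' _ hj]
      exact Nat.sub_le_sub_right (YoungDiagram.rowLen_anti _ _ _ (Nat.le_succ k)) j
  · refine fun hL => ⟨hT, fun j k => ?_⟩
    rcases le_total j (firstPart S.inner) with hj | hj
    · have h1 := hL.lattice j k
      rw [tailCount_rigidify (h := h) hrow hrigid hj, tailCount_rigidify (h := h) hrow hrigid hj]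
      split_ifs <;> omega
    · rw [tailCount_of_rigid hrigid _ hj, tailCount_of_rigid hrigid _ hj]
      exact Nat.sub_le_sub_right (YoungDiagram.rowLen_anti _ _ _ (Nat.le_succ k)) j

/-- Full columns may be omitted. -/
theorem multiplicityFree_omitColumns (hn : len S.outer ≤ n)
    (hrow : ∀ i < len S.outer, firstPart S.inner + s ≤ S.outer.rowLen i) :
    MultiplicityFree S n ↔ MultiplicityFree (trimmed S 0 s h) n := by
  have hb : ∀ i j, j < firstPart S.inner →
      ((i, j) ∈ boxes (trimmed S 0 s h) ↔ (i, j) ∈ boxes S) := fun i j hj =>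
    boxes_trimmed_iff hrow hj
  have hn' : len (trimmed S 0 s h).outer ≤ n := by
    refine le_trans ?_ hn
    by_contra hlt
    rw [not_le, lt_len_iff] at hlt
    exact lt_irrefl _ (lt_len_of_mem (mem_trim.1 hlt))
  have htab : ∀ T, IsLR S n T →
      IsTableau (trimmed S 0 s h) n (rigidify (firstPart S.inner) T) := fun T hT =>
    hT.toIsTableau.rigidify (fun _ _ hb => hT.le_row hb) hn' hb
  refine multiplicityFree_congr (rigidify (firstPart S.inner)) (fun T hT => ?_) (fun T' hT' => ?_)
    (fun T₁ T₂ h₁ h₂ => ?_) fun T₁ T₂ h₁ h₂ => ?_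
  · exact (isLR_iff_rigidify hrow hT.toIsTableau (fun _ _ => hT.eq_row) (fun _ _ => hT.le_row)
      (htab T hT)).1 hT
  · have htab' : IsTableau S n (rigidify (firstPart S.inner) T') :=
      hT'.toIsTableau.rigidify (S := trimmed S 0 s h) (fun _ _ hb => hT'.le_row hb) hn
        fun i j hj => (hb i j hj).symm
    have hrr : ∀ i j, (i, j) ∈ boxes (trimmed S 0 s h) →
        rigidify (firstPart S.inner) (rigidify (firstPart S.inner) T') i j = T' i j :=
      fun i j hb' => by
        by_cases hj : j < firstPart S.inner
        · rw [rigidify, if_pos hj, rigidify, if_pos hj]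
        · rw [rigidify, if_neg hj, hT'.eq_row hb' (not_lt.1 hj)]
    refine ⟨_, (isLR_iff_rigidify hrow htab' (fun i j _ hj => if_neg (not_lt.2 hj))
      (fun i j hb' => ?_) (hT'.toIsTableau.congr hrr)).2 (hT'.congr hrr), hrr⟩
    by_cases hj : j < firstPart S.inner
    · rw [rigidify, if_pos hj]
      exact hT'.le_row ((hb i j hj).2 hb')
    · rw [rigidify, if_neg hj]
  · refine forall₂_congr fun k _ => ?_
    rw [← tailCount_zero, ← tailCount_zero, ← tailCount_zero, ← tailCount_zero,
      tailCount_rigidify (h := h) hrow (fun _ _ => h₁.eq_row) (Nat.zero_le _),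
      tailCount_rigidify (h := h) hrow (fun _ _ => h₂.eq_row) (Nat.zero_le _), Nat.add_right_cancel_iff]
  · constructor
    · intro he i j hb'
      by_cases hj : j < firstPart S.inner
      · rw [rigidify, if_pos hj, rigidify, if_pos hj, he _ _ ((hb i j hj).1 hb')]
      · rw [rigidify, if_neg hj, rigidify, if_neg hj]
    · intro he i j hb'
      by_cases hj : j < firstPart S.inner
      · have := he i j ((hb i j hj).2 hb')
        rwa [rigidify, if_pos hj, rigidify, if_pos hj] at this
      · rw [h₁.eq_row hb' (not_lt.1 hj), h₂.eq_row hb' (not_lt.1 hj)]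

end OmitColumns

/-! ### Rotation -/

/-- The skew diagram, turned by 180 degrees. -/
def rotate (S : SkewPartition) : SkewPartition :=
  ⟨complement (firstPart S.outer) (len S.outer) S.inner,
    complement (firstPart S.outer) (len S.outer) S.outer, complement_anti _ _ S.le⟩

theorem mem_complement {a b i j : ℕ} {lam : YoungDiagram} :
    (i, j) ∈ complement a b lam ↔ (i < b ∧ j < a) ∧ (b - 1 - i, a - 1 - j) ∉ lam := by
  rw [← YoungDiagram.mem_cells]
  simp [complement]

theorem mem_boxes_rotate {i j : ℕ} : (i, j) ∈ boxes (rotate S) ↔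
    (i < len S.outer ∧ j < firstPart S.outer) ∧
      (len S.outer - 1 - i, firstPart S.outer - 1 - j) ∈ boxes S := by
  rw [mem_boxes, mem_boxes]
  simp only [rotate, mem_complement]
  tauto

/-- The filling, turned by 180 degrees and with reversed entries. -/
def rotateTableau (S : SkewPartition) (n : ℕ) (T : ℕ → ℕ → ℕ) (i j : ℕ) : ℕ :=
  n - 1 - T (len S.outer - 1 - i) (firstPart S.outer - 1 - j)

theorem mem_boxes_rotate_of_mem {i j : ℕ} (hb : (i, j) ∈ boxes S) :
    (i < len S.outer ∧ j < firstPart S.outer) ∧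
      (len S.outer - 1 - i, firstPart S.outer - 1 - j) ∈ boxes (rotate S) := by
  have h1 := lt_len_of_mem (mem_boxes.1 hb).1
  have h2 := lt_firstPart_of_mem (mem_boxes.1 hb).1
  refine ⟨⟨h1, h2⟩, mem_boxes_rotate.2 ⟨⟨by omega, by omega⟩, ?_⟩⟩
  rwa [Nat.sub_sub_self (by omega), Nat.sub_sub_self (by omega)]

theorem IsTableau.rotate {T : ℕ → ℕ → ℕ} (hT : IsTableau S n T) :
    IsTableau (SkewSchur.rotate S) n (rotateTableau S n T) := by
  refine ⟨fun i j hb => ?_, fun i j j' hb hb' hj => ?_, fun i i' j hb hb' hi => ?_⟩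
  · have := hT.lt _ _ (mem_boxes_rotate.1 hb).2
    rw [rotateTableau]
    omega
  · rw [mem_boxes_rotate] at hb hb'
    have := hT.row _ _ _ hb'.2 hb.2 (by omega)
    rw [rotateTableau, rotateTableau]
    omega
  · rw [mem_boxes_rotate] at hb hb'
    have := hT.col _ _ _ hb'.2 hb.2 (by omega)
    have := hT.lt _ _ hb.2
    rw [rotateTableau, rotateTableau]
    omega

theorem IsTableau.of_rotate {T : ℕ → ℕ → ℕ} (hT : IsTableau (SkewSchur.rotate S) n T) :
    IsTableau S n (rotateTableau S n T) := by
  refine ⟨fun i j hb => ?_, fun i j j' hb hb' hj => ?_, fun i i' j hb hb' hi => ?_⟩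
  · have := hT.lt _ _ (mem_boxes_rotate_of_mem hb).2
    rw [rotateTableau]
    omega
  · have h1 := mem_boxes_rotate_of_mem hb
    have h2 := mem_boxes_rotate_of_mem hb'
    have := hT.row _ _ _ h2.2 h1.2 (by omega)
    rw [rotateTableau, rotateTableau]
    omega
  · have h1 := mem_boxes_rotate_of_mem hb
    have h2 := mem_boxes_rotate_of_mem hb'
    have := hT.col _ _ _ h2.2 h1.2 (by omega)
    have := hT.lt _ _ h1.2
    rw [rotateTableau, rotateTableau]
    omega

theorem weight_rotate {T : ℕ → ℕ → ℕ} (hT : IsTableau S n T) {k : ℕ} (hk : k < n) :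
    weight (rotate S) (rotateTableau S n T) k = weight S T (n - 1 - k) := by
  rw [weight, weight]
  refine Finset.card_bij'
    (fun b _ => (len S.outer - 1 - b.1, firstPart S.outer - 1 - b.2))
    (fun b _ => (len S.outer - 1 - b.1, firstPart S.outer - 1 - b.2)) ?_ ?_ ?_ ?_
  · rintro ⟨i, j⟩ hb
    rw [Finset.mem_filter, mem_boxes_rotate] at hb
    refine Finset.mem_filter.2 ⟨hb.1.2, ?_⟩
    have h1 := hT.lt _ _ hb.1.2
    have h2 := hb.2
    simp only [rotateTableau] at h2 ⊢
    omega
  · rintro ⟨i, j⟩ hb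
    rw [Finset.mem_filter] at hb
    have h1 := mem_boxes_rotate_of_mem hb.1
    refine Finset.mem_filter.2 ⟨h1.2, ?_⟩
    have h2 := hb.2
    simp only [rotateTableau] at h2 ⊢
    rw [Nat.sub_sub_self (by omega), Nat.sub_sub_self (by omega)]
    omega
  · rintro ⟨i, j⟩ hb
    rw [Finset.mem_filter, mem_boxes_rotate] at hb
    simp only [Prod.mk.injEq]
    omega
  · rintro ⟨i, j⟩ hb
    rw [Finset.mem_filter] at hb
    have h1 := mem_boxes_rotate_of_mem hb.1
    simp only [Prod.mk.injEq]
    omega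

theorem rotateTableau_rotateTableau {T : ℕ → ℕ → ℕ} {i j : ℕ} (hi : i < len S.outer)
    (hj : j < firstPart S.outer) (hT : T i j < n) :
    rotateTableau S n (rotateTableau S n T) i j = T i j := by
  have e1 : len S.outer - 1 - (len S.outer - 1 - i) = i := by omega
  have e2 : firstPart S.outer - 1 - (firstPart S.outer - 1 - j) = j := by omega
  simp only [rotateTableau, e1, e2]
  omega

theorem rotateTableau_congr {T T' : ℕ → ℕ → ℕ} {i j : ℕ}
    (h : T (len S.outer - 1 - i) (firstPart S.outer - 1 - j) =
      T' (len S.outer - 1 - i) (firstPart S.outer - 1 - j)) :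
    rotateTableau S n T i j = rotateTableau S n T' i j := by
  rw [rotateTableau, rotateTableau, h]

/-- Rotating a filling and reversing its entries is a bijection that reverses the content, and
reversing the variables does not change a symmetric polynomial. -/
theorem skewSchur_rotate : skewSchur (rotate S) n = skewSchur S n := by
  rw [← isSymmetric_skewSchur (S := S) Fin.revPerm, skewSchur_eq, skewSchur_eq, map_sum]
  symm
  refine Finset.sum_bij'
    (fun F hF => restrict (rotate S) _ (mem_tableaux.1 hF).rotate.lt)
    (fun F hF => restrict S _ (mem_tableaux.1 hF).of_rotate.lt)
    (fun F hF => restrict_mem_tableaux (mem_tableaux.1 hF).rotate)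
    (fun F hF => restrict_mem_tableaux (mem_tableaux.1 hF).of_rotate)
    (fun F hF => ?_) (fun F hF => ?_) fun F hF => ?_
  · refine restrict_extend_eq _ fun i j hb => ?_
    have h1 := mem_boxes_rotate_of_mem hb
    rw [rotateTableau_congr (extend_restrict h1.2),
      rotateTableau_rotateTableau h1.1.1 h1.1.2 ((mem_tableaux.1 hF).lt _ _ hb)]
  · refine restrict_extend_eq _ fun i j hb => ?_
    have h1 := mem_boxes_rotate.1 hb
    rw [rotateTableau_congr (extend_restrict h1.2),
      rotateTableau_rotateTableau h1.1.1 h1.1.2 ((mem_tableaux.1 hF).lt _ _ hb)]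
  · rw [rename_prod_X_pow]
    refine Finset.prod_congr rfl fun i _ => ?_
    congr 1
    rw [content_eq_weight, content_eq_weight, weight_congr fun _ _ hb => extend_restrict hb,
      weight_rotate (mem_tableaux.1 hF) i.2]
    congr 1
    simp only [Fin.revPerm_symm, Fin.revPerm_apply, Fin.val_rev]
    omega

theorem multiplicityFree_rotate : MultiplicityFree (rotate S) n ↔ MultiplicityFree S n := by
  rw [MultiplicityFree, MultiplicityFree, skewSchur_rotate]

end SkewSchur

namespace SkewSchur

/-! ### Deletion of rows and columns -/

/-- The index before deletion of the `a`-th row or column that is not in `R`. -/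
noncomputable def keep (R : Finset ℕ) (a : ℕ) : ℕ := Nat.nth (· ∉ R) a

theorem infinite_notMem (R : Finset ℕ) : (Set.ofPred fun i => i ∉ R).Infinite :=
  R.finite_toSet.infinite_compl

theorem keep_strictMono (R : Finset ℕ) : StrictMono (keep R) :=
  Nat.nth_strictMono (infinite_notMem R)

theorem keep_notMem (R : Finset ℕ) (a : ℕ) : keep R a ∉ R :=
  Nat.nth_mem_of_infinite (infinite_notMem R) a

theorem keep_count {R : Finset ℕ} {i : ℕ} (h : i ∉ R) : keep R (Nat.count (· ∉ R) i) = i :=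
  Nat.nth_count h

theorem count_keep (R : Finset ℕ) (a : ℕ) : Nat.count (· ∉ R) (keep R a) = a :=
  Nat.count_nth_of_infinite (infinite_notMem R) a

theorem count_le_iff {R : Finset ℕ} {i a : ℕ} : Nat.count (· ∉ R) i ≤ a ↔ i ≤ keep R a :=
  Nat.count_le_iff_le_nth (infinite_notMem R)

theorem mem_deleteDiagram {R C : Finset ℕ} {lam : YoungDiagram} {a b : ℕ} :
    (a, b) ∈ deleteDiagram R C lam ↔ (keep R a, keep C b) ∈ lam := by
  rw [← YoungDiagram.mem_cells]
  simp only [deleteDiagram, Finset.mem_image, Finset.mem_filter, YoungDiagram.mem_cells,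
    Prod.exists, Prod.mk.injEq]
  constructor
  · rintro ⟨i, j, ⟨hm, hi, hj⟩, rfl, rfl⟩
    rwa [keep_count hi, keep_count hj]
  · exact fun h => ⟨_, _, ⟨h, keep_notMem R a, keep_notMem C b⟩, count_keep R a, count_keep C b⟩

theorem mem_boxes_delete {R C : Finset ℕ} {S : SkewPartition} {a b : ℕ} :
    (a, b) ∈ boxes (delete R C S) ↔ (keep R a, keep C b) ∈ boxes S := by
  rw [mem_boxes, mem_boxes]
  simp only [delete, mem_deleteDiagram]

theorem colSize_eq {S : SkewPartition} (j : ℕ) :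
    colSize S j = S.outer.colLen j - S.inner.colLen j := by
  rw [colSize, ← Nat.card_Ico]
  refine Finset.card_bij' (fun b _ => b.1) (fun i _ => (i, j)) ?_ ?_ ?_ ?_
  · rintro ⟨i, j'⟩ hb
    rw [Finset.mem_filter] at hb
    obtain ⟨hb, rfl⟩ := hb
    exact Finset.mem_Ico.2 (mem_boxes_iff_colLen.1 hb)
  · exact fun i hi => Finset.mem_filter.2 ⟨mem_boxes_iff_colLen.2 (Finset.mem_Ico.1 hi), rfl⟩
  · rintro ⟨i, j'⟩ hb
    rw [Finset.mem_filter] at hb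
    rw [Prod.mk.injEq]
    exact ⟨rfl, hb.2.symm⟩
  · intros; rfl

theorem rowSize_eq {S : SkewPartition} (i : ℕ) :
    rowSize S i = S.outer.rowLen i - S.inner.rowLen i := by
  rw [rowSize, ← Nat.card_Ico]
  refine Finset.card_bij' (fun b _ => b.2) (fun j _ => (i, j)) ?_ ?_ ?_ ?_
  · rintro ⟨i', j⟩ hb
    rw [Finset.mem_filter] at hb
    obtain ⟨hb, rfl⟩ := hb
    exact Finset.mem_Ico.2 (mem_boxes_iff_rowLen.1 hb)
  · exact fun i hi => Finset.mem_filter.2 ⟨mem_boxes_iff_rowLen.2 (Finset.mem_Ico.1 hi), rfl⟩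
  · rintro ⟨i', j⟩ hb
    rw [Finset.mem_filter] at hb
    rw [Prod.mk.injEq]
    exact ⟨hb.2.symm, rfl⟩
  · intros; rfl

section Delete

variable {S : SkewPartition} {n : ℕ} {R C : Finset ℕ} {T : ℕ → ℕ → ℕ}

/-- The columns in `C` with `n` boxes. -/
def fullColumns (S : SkewPartition) (n : ℕ) (C : Finset ℕ) : Finset ℕ :=
  C.filter fun j => S.outer.colLen j = S.inner.colLen j + n

theorem strict_lower_bound {f : ℕ → ℕ} {a b : ℕ}
    (hf : ∀ i i', a ≤ i → i < i' → i' < b → f i < f i') {i : ℕ} (ha : a ≤ i) (hb : i < b) :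
    i ≤ f i + a := by
  induction i with
  | zero => omega
  | succ i ih =>
    rcases ha.eq_or_lt with rfl | hlt
    · omega
    · have := hf i (i + 1) (by omega) (Nat.lt_succ_self i) hb
      have := ih (by omega) (by omega)
      omega

theorem strict_upper_bound {f : ℕ → ℕ} {a b n : ℕ}
    (hf : ∀ i i', a ≤ i → i < i' → i' < b → f i < f i') (hn : ∀ i, a ≤ i → i < b → f i < n)
    {i : ℕ} (ha : a ≤ i) (hb : i < b) : f i + b ≤ n + i := by
  obtain ⟨d, hd⟩ : ∃ d, b = i + 1 + d := ⟨b - (i + 1), by omega⟩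
  induction d generalizing i with
  | zero =>
    have := hn i ha hb
    omega
  | succ d ih =>
    have := hf i (i + 1) ha (Nat.lt_succ_self i) (by omega)
    have := ih (i := i + 1) (by omega) (by omega) (by omega)
    omega

/-- A strictly increasing column of `n` entries below `n` leaves no choice. -/
theorem IsTableau.eq_of_full_column (hT : IsTableau S n T) {i j : ℕ} (hb : (i, j) ∈ boxes S)
    (hj : S.outer.colLen j = S.inner.colLen j + n) : T i j + S.inner.colLen j = i := by
  have hf : ∀ i i', S.inner.colLen j ≤ i → i < i' → i' < S.outer.colLen j → T i j < T i' j :=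
    fun i i' h1 h2 h3 => hT.col _ _ _ (mem_boxes_iff_colLen.2 ⟨h1, h2.trans h3⟩)
      (mem_boxes_iff_colLen.2 ⟨h1.trans h2.le, h3⟩) h2
  have hn : ∀ i, S.inner.colLen j ≤ i → i < S.outer.colLen j → T i j < n :=
    fun i h1 h2 => hT.lt _ _ (mem_boxes_iff_colLen.2 ⟨h1, h2⟩)
  obtain ⟨h1, h2⟩ := mem_boxes_iff_colLen.1 hb
  have e1 := strict_lower_bound hf h1 h2
  have e2 := strict_upper_bound hf hn h1 h2
  omega

/-- Each deleted full column contains every entry `k < n` exactly once, so the correction does not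
depend on `k` and cancels in the lattice condition. -/
theorem IsTableau.tailCount_delete (hT : IsTableau S n T) (hR : ∀ i ∈ R, ∀ j, (i, j) ∉ boxes S)
    (hC : ∀ j ∈ C, S.outer.colLen j = S.inner.colLen j ∨
      S.outer.colLen j = S.inner.colLen j + n) (j : ℕ) {k : ℕ} (hk : k < n) :
    tailCount S T j k =
      tailCount (delete R C S) (fun a b => T (keep R a) (keep C b)) (Nat.count (· ∉ C) j) k +
        ((fullColumns S n C).filter (j ≤ ·)).card := by
  have hunion : (colSet S T k).filter (j ≤ ·) =
      ((colSet (delete R C S) (fun a b => T (keep R a) (keep C b)) k).filter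
        (Nat.count (· ∉ C) j ≤ ·)).map ⟨keep C, (keep_strictMono C).injective⟩ ∪
      (fullColumns S n C).filter (j ≤ ·) := by
    ext x
    simp only [Finset.mem_union, Finset.mem_map, Finset.mem_filter, Function.Embedding.coeFn_mk,
      fullColumns, mem_colSet, mem_boxes_delete]
    constructor
    · rintro ⟨⟨i, hb, he⟩, hx⟩
      by_cases hxC : x ∈ C
      · refine Or.inr ⟨⟨hxC, (hC x hxC).resolve_left fun h => ?_⟩, hx⟩
        have := mem_boxes_iff_colLen.1 hb
        omega
      · have hiR : i ∉ R := fun hi => hR i hi x hb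
        refine Or.inl ⟨Nat.count (· ∉ C) x, ⟨⟨Nat.count (· ∉ R) i, ?_⟩, ?_⟩, keep_count hxC⟩
        · rw [keep_count hxC, keep_count hiR]
          exact ⟨hb, he⟩
        · rwa [count_le_iff, keep_count hxC]
    · rintro (⟨b, ⟨⟨a, hb, he⟩, hle⟩, rfl⟩ | ⟨⟨hxC, hfull⟩, hx⟩)
      · exact ⟨⟨_, hb, he⟩, count_le_iff.1 hle⟩
      · have hb : (k + S.inner.colLen x, x) ∈ boxes S := mem_boxes_iff_colLen.2 (by omega)
        have := hT.eq_of_full_column hb hfull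
        exact ⟨⟨_, hb, by omega⟩, hx⟩
  rw [tailCount, hunion, Finset.card_union_of_disjoint, Finset.card_map, tailCount]
  rw [Finset.disjoint_left]
  intro x hx hx'
  obtain ⟨b, -, rfl⟩ := Finset.mem_map.1 hx
  exact keep_notMem C b (Finset.mem_filter.1 (Finset.mem_filter.1 hx').1).1

theorem IsTableau.delete (hT : IsTableau S n T) :
    IsTableau (delete R C S) n fun a b => T (keep R a) (keep C b) where
  lt _ _ hb := hT.lt _ _ (mem_boxes_delete.1 hb)
  row _ _ _ hb hb' h :=
    hT.row _ _ _ (mem_boxes_delete.1 hb) (mem_boxes_delete.1 hb') (keep_strictMono C h)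
  col _ _ _ hb hb' h :=
    hT.col _ _ _ (mem_boxes_delete.1 hb) (mem_boxes_delete.1 hb') (keep_strictMono R h)

theorem isLR_iff_delete (hT : IsTableau S n T) (hR : ∀ i ∈ R, ∀ j, (i, j) ∉ boxes S)
    (hC : ∀ j ∈ C, S.outer.colLen j = S.inner.colLen j ∨
      S.outer.colLen j = S.inner.colLen j + n) :
    IsLR S n T ↔ IsLR (delete R C S) n fun a b => T (keep R a) (keep C b) := by
  constructor
  · refine fun hL => ⟨hT.delete, fun b k => ?_⟩
    rcases lt_or_ge (k + 1) n with hk | hk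
    · have := hL.lattice (keep C b) k
      rw [hT.tailCount_delete hR hC _ hk, hT.tailCount_delete hR hC _ (Nat.lt_of_succ_lt hk),
        count_keep] at this
      omega
    · rw [tailCount_eq_zero hT.delete hk]
      exact Nat.zero_le _
  · refine fun hL => ⟨hT, fun j k => ?_⟩
    rcases lt_or_ge (k + 1) n with hk | hk
    · rw [hT.tailCount_delete hR hC _ hk, hT.tailCount_delete hR hC _ (Nat.lt_of_succ_lt hk)]
      exact Nat.add_le_add_right (hL.lattice _ _) _
    · rw [tailCount_eq_zero hT hk]
      exact Nat.zero_le _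

/-- Empty rows, empty columns and columns with `n` boxes may be deleted. -/
theorem multiplicityFree_delete (hR : ∀ i ∈ R, ∀ j, (i, j) ∉ boxes S)
    (hC : ∀ j ∈ C, S.outer.colLen j = S.inner.colLen j ∨
      S.outer.colLen j = S.inner.colLen j + n) :
    MultiplicityFree S n ↔ MultiplicityFree (delete R C S) n := by
  have hkept : ∀ i j, (i, j) ∈ boxes S → j ∉ C →
      (Nat.count (· ∉ R) i, Nat.count (· ∉ C) j) ∈ boxes (delete R C S) := fun i j hb hj => by
    rw [mem_boxes_delete, keep_count hj, keep_count fun hi => hR i hi j hb]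
    exact hb
  have hfull : ∀ i j, (i, j) ∈ boxes S → j ∈ C → S.outer.colLen j = S.inner.colLen j + n :=
    fun i j hb hj => (hC j hj).resolve_left fun h => by
      have := mem_boxes_iff_colLen.1 hb
      omega
  refine multiplicityFree_congr (fun T a b => T (keep R a) (keep C b))
    (fun T hT => (isLR_iff_delete hT.toIsTableau hR hC).1 hT) (fun T' hT' => ?_)
    (fun T₁ T₂ h₁ h₂ => ?_) fun T₁ T₂ h₁ h₂ => ?_
  -- The forced full columns are inserted into `T'`. On empty columns the value is irrelevant.
  · let T : ℕ → ℕ → ℕ := fun i j => if j ∈ C then i - S.inner.colLen j else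
      T' (Nat.count (· ∉ R) i) (Nat.count (· ∉ C) j)
    have hin : ∀ i j, j ∈ C → T i j = i - S.inner.colLen j := fun i j hj => if_pos hj
    have hout : ∀ i j, j ∉ C → T i j = T' (Nat.count (· ∉ R) i) (Nat.count (· ∉ C) j) :=
      fun i j hj => if_neg hj
    have hcount : ∀ (R : Finset ℕ) (i i' : ℕ), i ∉ R → i < i' →
        Nat.count (· ∉ R) i < Nat.count (· ∉ R) i' := fun R i i' hi h => Nat.count_strict_mono hi h
    have hcol : ∀ i i' j, (i, j) ∈ boxes S → (i', j) ∈ boxes S → i < i' → T i j < T i' j := by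
      intro i i' j hb hb' hi
      by_cases hj : j ∈ C
      · rw [hin i j hj, hin i' j hj]
        have := (mem_boxes_iff_colLen.1 hb).1
        omega
      · rw [hout i j hj, hout i' j hj]
        exact hT'.col _ _ _ (hkept i j hb hj) (hkept i' j hb' hj)
          (hcount R i i' (fun h => hR i h j hb) hi)
    have hlt : ∀ i j, (i, j) ∈ boxes S → T i j < n := by
      intro i j hb
      by_cases hj : j ∈ C
      · rw [hin i j hj]
        have := hfull i j hb hj
        have := mem_boxes_iff_colLen.1 hb
        omega
      · rw [hout i j hj]
        exact hT'.lt _ _ (hkept i j hb hj)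
    have hcol' : ∀ j i i', S.inner.colLen j ≤ i → i < i' → i' < S.outer.colLen j →
        T i j < T i' j := fun j i i' h1 h2 h3 =>
      hcol _ _ _ (mem_boxes_iff_colLen.2 ⟨h1, h2.trans h3⟩)
        (mem_boxes_iff_colLen.2 ⟨h1.trans h2.le, h3⟩) h2
    have hTab : IsTableau S n T := by
      refine ⟨hlt, fun i j j' hb hb' hjj => ?_, hcol⟩
      have hb1 := mem_boxes_iff_colLen.1 hb
      have hb2 := mem_boxes_iff_colLen.1 hb'
      by_cases hj : j ∈ C
      -- A full column on the left has entries as small as strictness permits, and the inner columns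
      -- get no longer to the right.
      · have := strict_lower_bound (f := fun i => T i j') (hcol' j') hb2.1 hb2.2
        have := S.inner.colLen_anti j j' hjj.le
        rw [hin i j hj]
        omega
      · by_cases hj' : j' ∈ C
        -- A full column on the right has entries as large as the bound `n` permits, and the outer
        -- columns get no longer to the right.
        · have := strict_upper_bound (f := fun i => T i j) (hcol' j)
            (fun i h1 h2 => hlt i j (mem_boxes_iff_colLen.2 ⟨h1, h2⟩)) hb1.1 hb1.2
          have := S.outer.colLen_anti j j' hjj.le
          have := hfull i j' hb' hj'
          rw [hin i j' hj']
          omega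
        · rw [hout i j hj, hout i j' hj']
          exact hT'.row _ _ _ (hkept i j hb hj) (hkept i j' hb' hj') (hcount C j j' hj hjj)
    have he : (fun a b => T (keep R a) (keep C b)) = T' := by
      funext a b
      rw [hout _ _ (keep_notMem C b), count_keep, count_keep]
    refine ⟨T, (isLR_iff_delete hTab hR hC).2 ?_, fun i j _ => congrFun (congrFun he i) j⟩
    rwa [he]
  · refine forall₂_congr fun k hk => ?_
    rw [← tailCount_zero, ← tailCount_zero, ← tailCount_zero, ← tailCount_zero,
      h₁.toIsTableau.tailCount_delete hR hC 0 hk, h₂.toIsTableau.tailCount_delete hR hC 0 hk,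
      Nat.add_right_cancel_iff, Nat.count_zero]
  · constructor
    · exact fun he a b hb => he _ _ (mem_boxes_delete.1 hb)
    · intro he i j hb
      by_cases hj : j ∈ C
      · have e1 := h₁.eq_of_full_column hb (hfull i j hb hj)
        have e2 := h₂.eq_of_full_column hb (hfull i j hb hj)
        omega
      · have := he _ _ (hkept i j hb hj)
        simpa only [keep_count hj, keep_count fun hi => hR i hi j hb] using this

end Delete

end SkewSchur

namespace SkewSchur

variable {S : SkewPartition} {n : ℕ}

/-! ### Basic shapes -/

theorem rowSize_ne_zero {i : ℕ} : rowSize S i ≠ 0 ↔ ∃ j, (i, j) ∈ boxes S := by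
  simp [rowSize, Finset.filter_eq_empty_iff]

theorem colSize_ne_zero {j : ℕ} : colSize S j ≠ 0 ↔ ∃ i, (i, j) ∈ boxes S := by
  simp [colSize, Finset.filter_eq_empty_iff]

theorem colLen_inner_le (S : SkewPartition) (j : ℕ) : S.inner.colLen j ≤ S.outer.colLen j := by
  refine le_of_forall_lt fun i hi => ?_
  rw [← YoungDiagram.mem_iff_lt_colLen] at hi ⊢
  exact S.le hi

/-- The rows that the basic demolition deletes. -/
def emptyRows (S : SkewPartition) : Finset ℕ :=
  (Finset.range (len S.outer)).filter fun k => rowSize S k = 0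

/-- The columns that the basic demolition deletes. -/
def emptyColumns (S : SkewPartition) : Finset ℕ :=
  (Finset.range (firstPart S.outer)).filter fun k => colSize S k = 0

theorem notMem_emptyRows {i j : ℕ} (hb : (i, j) ∈ boxes S) : i ∉ emptyRows S := fun h =>
  rowSize_ne_zero.2 ⟨j, hb⟩ (Finset.mem_filter.1 h).2

theorem notMem_emptyColumns {i j : ℕ} (hb : (i, j) ∈ boxes S) : j ∉ emptyColumns S := fun h =>
  colSize_ne_zero.2 ⟨i, hb⟩ (Finset.mem_filter.1 h).2

theorem basicDemolition_eq : basicDemolition S = delete (emptyRows S) (emptyColumns S) S := rfl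

theorem mem_boxes_basicDemolition {i j : ℕ} (hb : (i, j) ∈ boxes S) :
    (Nat.count (· ∉ emptyRows S) i, Nat.count (· ∉ emptyColumns S) j) ∈
      boxes (basicDemolition S) := by
  rw [basicDemolition_eq, mem_boxes_delete, keep_count (notMem_emptyRows hb),
    keep_count (notMem_emptyColumns hb)]
  exact hb

/-- A row and a column that meet in a box are both kept, so every box survives and no kept row or
column becomes empty. -/
theorem isBasic_basicDemolition (S : SkewPartition) : IsBasic (basicDemolition S) := by
  constructor
  · intro a ha
    rw [lt_len_iff, basicDemolition_eq, delete, mem_deleteDiagram] at ha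
    have h1 := keep_notMem (emptyRows S) a
    rw [emptyRows, Finset.mem_filter, not_and, ← emptyRows] at h1
    obtain ⟨j, hj⟩ := rowSize_ne_zero.1 (h1 (Finset.mem_range.2 (lt_len_of_mem ha)))
    have := mem_boxes_basicDemolition hj
    rw [count_keep] at this
    exact rowSize_ne_zero.2 ⟨_, this⟩
  · intro b hb
    rw [lt_firstPart_iff, basicDemolition_eq, delete, mem_deleteDiagram] at hb
    have h1 := keep_notMem (emptyColumns S) b
    rw [emptyColumns, Finset.mem_filter, not_and, ← emptyColumns] at h1
    obtain ⟨i, hi⟩ := colSize_ne_zero.1 (h1 (Finset.mem_range.2 (lt_firstPart_of_mem hb)))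
    have := mem_boxes_basicDemolition hi
    rw [count_keep] at this
    exact colSize_ne_zero.2 ⟨_, this⟩

theorem multiplicityFree_basicDemolition :
    MultiplicityFree S n ↔ MultiplicityFree (basicDemolition S) n := by
  refine multiplicityFree_delete (fun i hi j hb => notMem_emptyRows hb hi) fun j hj => Or.inl ?_
  have h1 := (Finset.mem_filter.1 hj).2
  rw [colSize_eq] at h1
  have := colLen_inner_le S j
  omega

theorem keep_zero {R : Finset ℕ} (h : 0 ∉ R) : keep R 0 = 0 := by
  simpa using keep_count h

theorem keep_empty (a : ℕ) : keep ∅ a = a := by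
  simpa using keep_count (Finset.notMem_empty a)

theorem deleteDiagram_empty (lam : YoungDiagram) : deleteDiagram ∅ ∅ lam = lam := by
  ext ⟨a, b⟩
  rw [YoungDiagram.mem_cells, YoungDiagram.mem_cells, mem_deleteDiagram, keep_empty, keep_empty]

theorem basicDemolition_of_isBasic (h : IsBasic S) : basicDemolition S = S := by
  have h1 : emptyRows S = ∅ :=
    Finset.filter_eq_empty_iff.2 fun k hk => h.1 k (Finset.mem_range.1 hk)
  have h2 : emptyColumns S = ∅ :=
    Finset.filter_eq_empty_iff.2 fun k hk => h.2 k (Finset.mem_range.1 hk)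
  rw [basicDemolition_eq, h1, h2]
  exact SkewPartition.ext (deleteDiagram_empty _) (deleteDiagram_empty _)

/-! ### Sharp shapes -/

theorem colSize_delete_le (R C : Finset ℕ) (b : ℕ) :
    colSize (delete R C S) b ≤ colSize S (keep C b) := by
  refine Finset.card_le_card_of_injOn (fun x => (keep R x.1, keep C x.2)) ?_ ?_
  · rintro ⟨i, j⟩ hb
    rw [Finset.mem_coe, Finset.mem_filter] at hb
    obtain ⟨hb, rfl⟩ := hb
    exact Finset.mem_coe.2 (Finset.mem_filter.2 ⟨mem_boxes_delete.1 hb, rfl⟩)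
  · rintro ⟨i, j⟩ - ⟨i', j'⟩ - he
    rw [Prod.mk.injEq] at he
    exact Prod.ext ((keep_strictMono R).injective he.1) ((keep_strictMono C).injective he.2)

theorem lt_firstPart_delete {R C : Finset ℕ} {b : ℕ} (h : b < firstPart (delete R C S).outer) :
    keep C b < firstPart S.outer := by
  rw [lt_firstPart_iff, delete, mem_deleteDiagram] at h
  exact lt_firstPart_of_mem h

theorem IsSharp.basicDemolition (h : IsSharp n S) : IsSharp n (basicDemolition S) := fun b hb =>
  (colSize_delete_le _ _ b).trans_lt (h _ (lt_firstPart_delete hb))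

theorem isSharp_sharpDemolition (n : ℕ) (S : SkewPartition) : IsSharp n (sharpDemolition n S) := by
  rw [sharpDemolition]
  split_ifs with h
  · exact fun k hk => absurd (lt_firstPart_iff.1 hk) (YoungDiagram.notMem_bot _)
  · push Not at h
    intro b hb
    have h1 := lt_firstPart_delete hb
    have h2 := h _ h1
    have h3 : colSize S (keep _ b) ≠ n := fun he =>
      keep_notMem _ b (Finset.mem_filter.2 ⟨Finset.mem_range.2 h1, he⟩)
    exact (colSize_delete_le _ _ b).trans_lt (lt_of_le_of_ne h2 h3)

theorem multiplicityFree_sharpDemolition :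
    MultiplicityFree S n ↔ MultiplicityFree (sharpDemolition n S) n := by
  rw [sharpDemolition]
  split_ifs with h
  · obtain ⟨k, -, hk⟩ := h
    rw [colSize_eq] at hk
    have h1 : ∀ T, ¬ IsTableau S n T := fun T hT => by
      have hb : (S.outer.colLen k - 1, k) ∈ boxes S := mem_boxes_iff_colLen.2 (by omega)
      have h1 := hT.le_add_colLen hb
      have h2 := hT.lt _ _ hb
      omega
    rw [multiplicityFree_iff, multiplicityFree_iff]
    -- Both sides hold trivially: the shape has no tableaux at all, and the empty shape has no boxes
    -- on which two tableaux could differ.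
    refine iff_of_true (fun T _ hT => absurd hT.toIsTableau (h1 T)) fun T T' _ _ _ i j hb => ?_
    exact absurd (mem_boxes_straight.1 hb) (YoungDiagram.notMem_bot _)
  · refine multiplicityFree_delete (by simp) fun j hj => Or.inr ?_
    have h1 := (Finset.mem_filter.1 hj).2
    rw [colSize_eq] at h1
    have := colLen_inner_le S j
    omega

/-! ### Parts -/

theorem lt_firstMult_iff {lam : YoungDiagram} {i : ℕ} :
    i < firstMult lam ↔ i < len lam ∧ lam.rowLen i = firstPart lam := by
  refine ⟨rowLen_eq_of_lt_firstMult, fun ⟨hi, he⟩ => ?_⟩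
  have hc : firstMult lam = ((Finset.range (len lam)).filter
      fun k => lam.rowLen k = firstPart lam).card := by
    simp only [firstMult, YoungDiagram.rowLens, len, List.count, List.countP_map]
    rw [Finset.card_def, Finset.filter_val, Finset.range_val, Multiset.range, Multiset.filter_coe,
      Multiset.coe_card, List.countP_eq_length_filter]
    congr 1
  have hsub : Finset.range (i + 1) ⊆ (Finset.range (len lam)).filter
      fun k => lam.rowLen k = firstPart lam := fun k hk => by
    rw [Finset.mem_range] at hk
    refine Finset.mem_filter.2 ⟨Finset.mem_range.2 (by omega), ?_⟩
    have h1 := lam.rowLen_anti k i (by omega)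
    have h2 := rowLen_le_firstPart lam k
    omega
  have := Finset.card_le_card hsub
  rw [Finset.card_range] at this
  omega

theorem lastPart_le {lam : YoungDiagram} {i : ℕ} (hi : i < len lam) :
    lastPart lam ≤ lam.rowLen i := lam.rowLen_anti i _ (by omega)

theorem mem_parts {lam : YoungDiagram} {v : ℕ} :
    v ∈ lam.rowLens.toFinset ↔ ∃ i < len lam, lam.rowLen i = v := by
  simp [YoungDiagram.rowLens, len]

theorem ne_bot_iff {lam : YoungDiagram} : lam ≠ ⊥ ↔ (0, 0) ∈ lam := by
  constructor
  · intro h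
    by_contra h0
    refine h (YoungDiagram.ext (Finset.eq_empty_of_forall_notMem fun b hb => h0 ?_))
    exact lam.up_left_mem (Nat.zero_le _) (Nat.zero_le _) ((YoungDiagram.mem_cells _).1 hb)
  · rintro h rfl
    exact YoungDiagram.notMem_bot _ h

theorem lastPart_lt_firstPart {lam : YoungDiagram} (h0 : lam ≠ ⊥) (h : ¬ IsRectangle lam) :
    lastPart lam < firstPart lam := by
  by_contra hle
  refine h (Finset.card_eq_one.2 ⟨firstPart lam, ?_⟩)
  ext v
  rw [mem_parts, Finset.mem_singleton]
  constructor
  · rintro ⟨i, hi, rfl⟩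
    have h1 := lastPart_le hi
    have h2 := rowLen_le_firstPart lam i
    omega
  · rintro rfl
    exact ⟨0, lt_len_iff.2 (ne_bot_iff.1 h0), rfl⟩

/-- The numerical data of a basic shape to which `tau` and `sigma` properly apply. -/
structure IsProper (S : SkewPartition) : Prop where
  len_pos : 0 < len S.inner
  firstPart_pos : 0 < firstPart S.inner
  len_lt : len S.inner < len S.outer
  firstPart_lt : firstPart S.inner < firstPart S.outer
  lastPart_lt : lastPart S.outer < firstPart S.outer
  lastPart_pos : 0 < lastPart S.outer
  firstMult_lt : firstMult S.outer < len S.outer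
  firstMult_pos : 0 < firstMult S.outer
  tau_eq : tau S = firstMult S.outer - min (firstMult S.outer) (len S.inner)
  sigma_eq : sigma S = lastPart S.outer - min (firstPart S.inner) (lastPart S.outer)

theorem isProper (h : IsBasic S) (hd : ¬ (S.inner = ⊥ ∨ IsRectangle S.outer)) : IsProper S := by
  obtain ⟨h1, h2⟩ := not_or.1 hd
  have h0 := ne_bot_iff.1 h1
  have h0' : (0, 0) ∈ S.outer := S.le h0
  have hl := lt_len_iff.2 h0'
  have hf := lt_firstPart_iff.2 h0'
  have hlast := lastPart_lt_firstPart (ne_bot_iff.2 h0') h2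
  refine ⟨lt_len_iff.2 h0, lt_firstPart_iff.2 h0, ?_, ?_, hlast, ?_, ?_, ?_, ?_, ?_⟩
  · have := h.2 0 hf
    rw [colSize_eq] at this
    exact Nat.lt_of_sub_ne_zero this
  · have := h.1 0 hl
    rw [rowSize_eq] at this
    exact Nat.lt_of_sub_ne_zero this
  · exact YoungDiagram.mem_iff_lt_rowLen.1 (lt_len_iff.1 (by omega))
  · by_contra hle
    have := (lt_firstMult_iff.1 (show len S.outer - 1 < firstMult S.outer by omega)).2
    rw [lastPart] at hlast
    omega
  · exact lt_firstMult_iff.2 ⟨hl, rfl⟩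
  · rw [tau, if_neg hd]
  · rw [sigma, if_neg hd]

/-! ### Tight shapes -/

/-- A column that ends at or above the last row of the inner partition shows that the largest part
is repeated at most `len S.inner` times. This test survives deletions better than the multiplicity
itself. -/
theorem tau_eq_zero_of_mem {b : ℕ} (h : (0, b) ∈ S.outer) (h' : (len S.inner, b) ∉ S.outer) :
    tau S = 0 := by
  rw [tau]
  split_ifs
  · rfl
  · have : ¬ len S.inner < firstMult S.outer := fun hlt => h' <| by
      rw [YoungDiagram.mem_iff_lt_rowLen, (lt_firstMult_iff.1 hlt).2]
      exact lt_firstPart_of_mem h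
    omega

theorem sigma_eq_zero_of_mem {a : ℕ} (h : (a, 0) ∈ S.outer)
    (h' : (a, firstPart S.inner) ∉ S.outer) : sigma S = 0 := by
  rw [sigma]
  split_ifs
  · rfl
  · have h1 := lastPart_le (lt_len_of_mem h)
    rw [YoungDiagram.mem_iff_lt_rowLen] at h'
    omega

/-- Column `0` has `len S.outer - len S.inner` boxes, and the multiplicity of the largest part is at
most `len S.outer`. -/
theorem tau_le_colSize (hS : IsBasic S) : tau S ≤ colSize S 0 := by
  by_cases hd : S.inner = ⊥ ∨ IsRectangle S.outer
  · rw [tau, if_pos hd]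
    exact Nat.zero_le _
  · have hp := isProper hS hd
    have h1 := hp.tau_eq
    have h2 := hp.firstMult_lt
    rw [colSize_eq]
    change _ ≤ len S.outer - len S.inner
    omega

theorem tau_le (hS : IsBasic S) (hn : IsSharp n S) : tau S ≤ n := by
  rcases Nat.eq_zero_or_pos (firstPart S.outer) with h | h
  · have h1 : S.inner = ⊥ := by
      by_contra hne
      have := lt_firstPart_iff.2 (S.le (ne_bot_iff.1 hne))
      omega
    rw [tau, if_pos (Or.inl h1)]
    exact Nat.zero_le n
  · exact (tau_le_colSize hS).trans (hn 0 h).le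

theorem tightDemolition_eq : tightDemolition S =
    basicDemolition (trimmed S (tau S) (sigma S) (inner_le_trim S)) := rfl

theorem trimmed_zero {t s : ℕ} (ht : t = 0) (hs : s = 0) {h : S.inner ≤ trim t s S.outer} :
    trimmed S t s h = S := by
  subst ht hs
  refine SkewPartition.ext (YoungDiagram.ext ?_) rfl
  ext ⟨i, j⟩
  rw [YoungDiagram.mem_cells, YoungDiagram.mem_cells]
  exact mem_trim

theorem trimmed_trimmed {t s : ℕ} {h : S.inner ≤ trim t 0 S.outer}
    {h' : (trimmed S t 0 h).inner ≤ trim 0 s (trimmed S t 0 h).outer} {h'' : S.inner ≤ trim t s S.outer} :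
    trimmed (trimmed S t 0 h) 0 s h' = trimmed S t s h'' := by
  refine SkewPartition.ext (YoungDiagram.ext ?_) rfl
  ext ⟨i, j⟩
  rw [YoungDiagram.mem_cells, YoungDiagram.mem_cells]
  change (i, j) ∈ trim 0 s (trim t 0 S.outer) ↔ (i, j) ∈ trim t s S.outer
  rw [mem_trim, mem_trim, mem_trim, Nat.add_zero, Nat.add_zero]

theorem colLen_trim (t s : ℕ) (lam : YoungDiagram) (j : ℕ) :
    (trim t s lam).colLen j = lam.colLen (j + s) - t := by
  refine eq_of_forall_lt_iff fun i => ?_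
  rw [← YoungDiagram.mem_iff_lt_colLen, Nat.lt_sub_iff_add_lt, ← YoungDiagram.mem_iff_lt_colLen,
    mem_trim]

/-- Each column loses `τ` boxes or all it has, so it is no larger than the truncated difference;
sharpness of column `0` covers the case that nothing is left. -/
theorem IsSharp.trimmed (hS : IsBasic S) (hn : IsSharp n S) :
    IsSharp (n - tau S) (trimmed S (tau S) (sigma S) (inner_le_trim S)) := by
  intro j hj
  have hm : (tau S, j + sigma S) ∈ S.outer := by
    have := mem_trim.1 (lt_firstPart_iff.1 hj)
    rwa [Nat.zero_add] at this
  have h0 : (0, j) ∈ S.outer :=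
    S.outer.up_left_mem (Nat.zero_le _) (Nat.le_add_right _ _) hm
  have h1 := hn j (lt_firstPart_of_mem h0)
  have h2 := hn 0 (lt_firstPart_of_mem (S.outer.up_left_mem le_rfl (Nat.zero_le _) h0))
  have h3 := tau_le_colSize hS
  have h4 := S.outer.colLen_anti j (j + sigma S) (Nat.le_add_right _ _)
  rw [colSize_eq] at h1 ⊢
  change (trim _ _ _).colLen j - S.inner.colLen j < _
  rw [colLen_trim]
  omega

theorem multiplicityFree_trimmed (hS : IsBasic S) (hn : IsSharp n S) :
    MultiplicityFree S n ↔
      MultiplicityFree (trimmed S (tau S) (sigma S) (inner_le_trim S)) (n - tau S) := by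
  by_cases hd : S.inner = ⊥ ∨ IsRectangle S.outer
  · have h1 : tau S = 0 := by rw [tau, if_pos hd]
    have h2 : sigma S = 0 := by rw [sigma, if_pos hd]
    rw [trimmed_zero h1 h2, h1, Nat.sub_zero]
  have hp := isProper hS hd
  have ht := hp.tau_eq
  have hs := hp.sigma_eq
  have h1 : S.inner ≤ trim (tau S) 0 S.outer := by
    rw [← YoungDiagram.cells_subset_iff]
    rintro ⟨i, j⟩ hm
    have := inner_le_trim S ((YoungDiagram.mem_cells _).1 hm)
    rw [YoungDiagram.mem_cells]
    exact mem_trim.2 (S.outer.up_left_mem le_rfl (Nat.le_add_right _ _) (mem_trim.1 this))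
  have h2 : (trimmed S (tau S) 0 h1).inner ≤
      trim 0 (sigma S) (trimmed S (tau S) 0 h1).outer := by
    rw [← YoungDiagram.cells_subset_iff]
    rintro ⟨i, j⟩ hm
    have := inner_le_trim S ((YoungDiagram.mem_cells _).1 hm)
    rw [YoungDiagram.mem_cells]
    refine mem_trim.2 (mem_trim.2 ?_)
    rw [Nat.add_zero, Nat.add_zero]
    exact mem_trim.1 this
  have e1 : MultiplicityFree S n ↔ MultiplicityFree (trimmed S (tau S) 0 h1) (n - tau S) := by
    rcases Nat.eq_zero_or_pos (tau S) with h0 | h0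
    · rw [trimmed_zero h0 rfl, h0, Nat.sub_zero]
    -- If `τ > 0`, then `len S.inner + τ` is exactly the multiplicity of the largest part.
    · refine multiplicityFree_omitRows (tau_le hS hn) fun i hi => ?_
      exact (lt_firstMult_iff.1 (show i < firstMult S.outer by omega)).2
  rw [e1, ← trimmed_trimmed (h := h1) (h' := h2)]
  rcases Nat.eq_zero_or_pos (sigma S) with h0 | h0
  · rw [trimmed_zero rfl h0]
  · have hmem : ∀ i, i < len (trimmed S (tau S) 0 h1).outer → i + tau S < len S.outer :=
      fun i hi => lt_len_of_mem (mem_trim.1 (lt_len_iff.1 hi))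
    refine multiplicityFree_omitColumns ?_ fun i hi => ?_
    -- If `σ > 0`, the first column beyond the inner partition has full height, so sharpness bounds
    -- the number of rows.
    · have h3 := hn (firstPart S.inner) hp.firstPart_lt
      rw [colSize_eq, colLen_inner_eq_zero le_rfl, Nat.sub_zero] at h3
      have h4 : (len S.outer - 1, firstPart S.inner) ∈ S.outer := by
        rw [YoungDiagram.mem_iff_lt_rowLen]
        change _ < lastPart S.outer
        omega
      rw [YoungDiagram.mem_iff_lt_colLen] at h4
      by_contra hlt
      have := hmem (n - tau S) (not_le.1 hlt)
      omega
    · have h3 := lastPart_le (hmem i hi)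
      change firstPart S.inner + sigma S ≤ _
      by_contra hlt
      have h4 : (i, (trimmed S (tau S) 0 h1).outer.rowLen i) ∈ (trimmed S (tau S) 0 h1).outer := by
        refine mem_trim.2 ?_
        rw [YoungDiagram.mem_iff_lt_rowLen]
        omega
      rw [YoungDiagram.mem_iff_lt_rowLen] at h4
      exact lt_irrefl _ h4

/-- The two boxes keep row `0`, column `0`, row `I` and column `J` from being deleted, so the
witnesses for `τ = 0` and `σ = 0` persist. The inner partition may shrink, but its new length and
width correspond to old indices not below the old ones. -/
theorem tau_sigma_basicDemolition {I J : ℕ} (hright : (0, J) ∈ boxes S)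
    (hright' : (len S.inner, J) ∉ S.outer) (hbottom : (I, 0) ∈ boxes S)
    (hbottom' : (I, firstPart S.inner) ∉ S.outer) :
    tau (basicDemolition S) = 0 ∧ sigma (basicDemolition S) = 0 := by
  have hr := keep_zero (notMem_emptyRows hright)
  have hc := keep_zero (notMem_emptyColumns hbottom)
  have hJ := keep_count (notMem_emptyColumns hright)
  have hI := keep_count (notMem_emptyRows hbottom)
  have houter : (basicDemolition S).outer =
    deleteDiagram (emptyRows S) (emptyColumns S) S.outer := rfl
  have hinner : (basicDemolition S).inner =
    deleteDiagram (emptyRows S) (emptyColumns S) S.inner := rfl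
  constructor
  · refine tau_eq_zero_of_mem (b := Nat.count (· ∉ emptyColumns S) J) ?_ ?_
    · rw [houter, mem_deleteDiagram, hr, hJ]
      exact (mem_boxes.1 hright).1
    · rw [houter, mem_deleteDiagram, hJ]
      have h1 : (len (basicDemolition S).inner, 0) ∉ (basicDemolition S).inner := fun h =>
        lt_irrefl _ (lt_len_iff.2 h)
      rw [hinner, mem_deleteDiagram, hc, ← lt_len_iff, not_lt] at h1
      exact fun hm => hright' (S.outer.up_left_mem h1 le_rfl hm)
  · refine sigma_eq_zero_of_mem (a := Nat.count (· ∉ emptyRows S) I) ?_ ?_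
    · rw [houter, mem_deleteDiagram, hc, hI]
      exact (mem_boxes.1 hbottom).1
    · rw [houter, mem_deleteDiagram, hI]
      have h1 : (0, firstPart (basicDemolition S).inner) ∉ (basicDemolition S).inner := fun h =>
        lt_irrefl _ (lt_firstPart_iff.2 h)
      rw [hinner, mem_deleteDiagram, hr, ← lt_firstPart_iff, not_lt] at h1
      exact fun hm => hbottom' (S.outer.up_left_mem le_rfl h1 hm)

theorem isTight_tightDemolition (hS : IsBasic S) : IsTight (tightDemolition S) := by
  refine ⟨isBasic_basicDemolition _, ?_⟩
  by_cases hd : S.inner = ⊥ ∨ IsRectangle S.outer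
  · have h1 : tau S = 0 := by rw [tau, if_pos hd]
    have h2 : sigma S = 0 := by rw [sigma, if_pos hd]
    rw [tightDemolition_eq, trimmed_zero h1 h2, basicDemolition_of_isBasic hS]
    exact ⟨h1, h2⟩
  have hp := isProper hS hd
  have ht := hp.tau_eq
  have hs := hp.sigma_eq
  have hlast := hp.lastPart_lt
  have hmult := hp.firstMult_lt
  have hpos := hp.firstMult_pos
  have hlen := hp.len_lt
  have hlen0 := hp.len_pos
  have hfirst := hp.firstPart_lt
  have hfirst0 := hp.firstPart_pos
  have hlast0 := hp.lastPart_pos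
  -- The witnesses are the last column and the last row of the trimmed shape. As the inner partition
  -- is nonempty, `τ` is less than the multiplicity of the largest part, so the first row left keeps
  -- the full width.
  have hright : (0, firstPart S.outer - 1 - sigma S) ∈
      boxes (trimmed S (tau S) (sigma S) (inner_le_trim S)) := by
    rw [mem_boxes_trimmed, YoungDiagram.mem_iff_lt_rowLen, ← lt_firstPart_iff,
      (lt_firstMult_iff.1 (show 0 + tau S < firstMult S.outer by omega)).2]
    omega
  have hright' : (len S.inner, firstPart S.outer - 1 - sigma S) ∉
      (trimmed S (tau S) (sigma S) (inner_le_trim S)).outer := fun hm => by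
    have h1 := mem_trim.1 hm
    have h2 := lt_len_of_mem h1
    rw [YoungDiagram.mem_iff_lt_rowLen] at h1
    have h3 := rowLen_le_firstPart S.outer (len S.inner + tau S)
    have := lt_firstMult_iff.2 ⟨h2, show S.outer.rowLen (len S.inner + tau S) = _ by omega⟩
    omega
  have hbottom : (len S.outer - 1 - tau S, 0) ∈
      boxes (trimmed S (tau S) (sigma S) (inner_le_trim S)) := by
    rw [mem_boxes_trimmed, YoungDiagram.mem_iff_lt_rowLen, ← lt_len_iff,
      Nat.sub_add_cancel (by omega)]
    change 0 + sigma S < lastPart S.outer ∧ _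
    omega
  have hbottom' : (len S.outer - 1 - tau S, firstPart S.inner) ∉
      (trimmed S (tau S) (sigma S) (inner_le_trim S)).outer := fun hm => by
    have h1 := mem_trim.1 hm
    rw [YoungDiagram.mem_iff_lt_rowLen, Nat.sub_add_cancel (by omega)] at h1
    change _ < lastPart S.outer at h1
    omega
  exact tau_sigma_basicDemolition hright hright' hbottom hbottom'

/-! ### Ordinary shapes -/

theorem ordinaryReduction_eq [Decidable (np S.inner + 1 < np S.outer ∧ S.inner ≠ ⊥)] :
    ordinaryReduction S =
      if np S.inner + 1 < np S.outer ∧ S.inner ≠ ⊥ then rotate S else S := by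
  rw [ordinaryReduction]
  congr

theorem IsBasic.rotate (hS : IsBasic S) : IsBasic (rotate S) := by
  constructor
  · intro k hk
    have h1 := (mem_complement.1 (lt_len_iff.1 hk)).1.1
    obtain ⟨j, hj⟩ := rowSize_ne_zero.1 (hS.1 (len S.outer - 1 - k) (by omega))
    have := (mem_boxes_rotate_of_mem hj).2
    rw [Nat.sub_sub_self (by omega)] at this
    exact rowSize_ne_zero.2 ⟨_, this⟩
  · intro k hk
    have h1 := (mem_complement.1 (lt_firstPart_iff.1 hk)).1.2
    obtain ⟨i, hi⟩ := colSize_ne_zero.1 (hS.2 (firstPart S.outer - 1 - k) (by omega))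
    have := (mem_boxes_rotate_of_mem hi).2
    rw [Nat.sub_sub_self (by omega)] at this
    exact colSize_ne_zero.2 ⟨_, this⟩

theorem IsSharp.rotate (hS : IsSharp n S) : IsSharp n (rotate S) := by
  intro k hk
  have h1 := (mem_complement.1 (lt_firstPart_iff.1 hk)).1.2
  refine lt_of_le_of_lt ?_ (hS (firstPart S.outer - 1 - k) (by omega))
  refine Finset.card_le_card_of_injOn
    (fun b => (len S.outer - 1 - b.1, firstPart S.outer - 1 - b.2)) ?_ ?_
  · rintro ⟨i, j⟩ hb
    rw [Finset.mem_coe, Finset.mem_filter] at hb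
    obtain ⟨hb, rfl⟩ := hb
    exact Finset.mem_coe.2 (Finset.mem_filter.2 ⟨(mem_boxes_rotate.1 hb).2, rfl⟩)
  · rintro ⟨i, j⟩ hb ⟨i', j'⟩ hb' he
    rw [Finset.mem_coe, Finset.mem_filter, mem_boxes_rotate] at hb hb'
    simp only [Prod.mk.injEq] at he ⊢
    omega

theorem rowLen_complement {a b i : ℕ} (lam : YoungDiagram) (hi : i < b) :
    (complement a b lam).rowLen i = a - lam.rowLen (b - 1 - i) := by
  refine eq_of_forall_lt_iff fun j => ?_
  rw [← YoungDiagram.mem_iff_lt_rowLen, mem_complement, YoungDiagram.mem_iff_lt_rowLen]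
  omega

/-- The parts of the complement are differences `a - v`, where `v` is a part of `lam` or zero; the
zero accounts for the additional part. -/
theorem np_complement_le (a b : ℕ) (lam : YoungDiagram) :
    np (complement a b lam) ≤ np lam + 1 := by
  have hsub : (complement a b lam).rowLens.toFinset ⊆
      (insert 0 lam.rowLens.toFinset).image (a - ·) := by
    intro v hv
    obtain ⟨i, hi, rfl⟩ := mem_parts.1 hv
    have hib := (mem_complement.1 (lt_len_iff.1 hi)).1.1
    rw [rowLen_complement lam hib]
    refine Finset.mem_image_of_mem _ ?_
    rw [Finset.mem_insert, mem_parts]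
    rcases lt_or_ge (b - 1 - i) (len lam) with h | h
    · exact Or.inr ⟨_, h, rfl⟩
    · exact Or.inl (rowLen_eq_zero h)
  exact (Finset.card_le_card hsub).trans (Finset.card_image_le.trans (Finset.card_insert_le _ _))

/-- In its own bounding rectangle, a partition loses only the largest part, which becomes zero. -/
theorem np_le_np_complement (lam : YoungDiagram) :
    np lam ≤ np (complement (firstPart lam) (len lam) lam) + 1 := by
  have hsub : lam.rowLens.toFinset ⊆ insert (firstPart lam)
      ((complement (firstPart lam) (len lam) lam).rowLens.toFinset.image (firstPart lam - ·)) := by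
    intro v hv
    obtain ⟨i, hi, rfl⟩ := mem_parts.1 hv
    have h1 := rowLen_le_firstPart lam i
    have h2 := rowLen_complement (a := firstPart lam) lam
      (show len lam - 1 - i < len lam by omega)
    rw [Nat.sub_sub_self (by omega)] at h2
    rw [Finset.mem_insert, Finset.mem_image]
    rcases h1.eq_or_lt with h | h
    · exact Or.inl h
    · refine Or.inr ⟨firstPart lam - lam.rowLen i, mem_parts.2 ⟨_, ?_, h2⟩, by omega⟩
      rw [lt_len_iff, YoungDiagram.mem_iff_lt_rowLen, h2]
      omega
  exact (Finset.card_le_card hsub).trans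
    ((Finset.card_insert_le _ _).trans (Nat.add_le_add_right Finset.card_image_le 1))

/-- Tightness says that the multiplicity of the largest outer part is at most `len S.inner`, and the
smallest outer part at most `firstPart S.inner`. Taking complements and exchanging the partitions
turns each inequality into itself. -/
theorem IsTight.rotate (hS : IsTight S) (h0 : S.inner ≠ ⊥) (hnp : np S.inner + 1 < np S.outer) :
    IsTight (rotate S) := by
  have hp := isProper hS.1 (not_or.2 ⟨h0, fun h => by rw [IsRectangle] at h; omega⟩)
  have ht := hp.tau_eq
  have hs := hp.sigma_eq
  rw [hS.2.1] at ht
  rw [hS.2.2] at hs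
  have hlen := hp.len_lt
  have hfirst := hp.firstPart_lt
  refine ⟨hS.1.rotate, ?_, ?_⟩
  · refine tau_eq_zero_of_mem (b := firstPart S.outer - 1) ?_ ?_
    · refine mem_complement.2 ⟨⟨by omega, by omega⟩, fun hm => ?_⟩
      have := lt_len_of_mem hm
      omega
    · intro hm
      obtain ⟨⟨h1, -⟩, h3⟩ := mem_complement.1 hm
      have h4 : (len (SkewSchur.rotate S).inner, 0) ∉ (SkewSchur.rotate S).inner := fun h =>
        lt_irrefl _ (lt_len_iff.2 h)
      apply h3
      rw [Nat.sub_self, ← lt_len_iff]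
      have h5 : (len S.outer - 1 - len (SkewSchur.rotate S).inner, firstPart S.outer - 1) ∈
          S.outer := by
        by_contra hn
        exact h4 (mem_complement.2 ⟨⟨h1, by omega⟩, hn⟩)
      have h6 := lt_len_of_mem h5
      rw [YoungDiagram.mem_iff_lt_rowLen] at h5
      have h7 := rowLen_le_firstPart S.outer (len S.outer - 1 - len (SkewSchur.rotate S).inner)
      have := lt_firstMult_iff.2 ⟨h6, by omega⟩
      omega
  · refine sigma_eq_zero_of_mem (a := len S.outer - 1) ?_ ?_
    · refine mem_complement.2 ⟨⟨by omega, by omega⟩, fun hm => ?_⟩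
      have := lt_firstPart_of_mem hm
      omega
    · intro hm
      obtain ⟨⟨-, h1⟩, h3⟩ := mem_complement.1 hm
      have h4 : (0, firstPart (SkewSchur.rotate S).inner) ∉ (SkewSchur.rotate S).inner := fun h =>
        lt_irrefl _ (lt_firstPart_iff.2 h)
      apply h3
      rw [Nat.sub_self, ← lt_firstPart_iff]
      have h5 : (len S.outer - 1, firstPart S.outer - 1 - firstPart (SkewSchur.rotate S).inner) ∈
          S.outer := by
        by_contra hn
        exact h4 (mem_complement.2 ⟨⟨by omega, h1⟩, hn⟩)
      rw [YoungDiagram.mem_iff_lt_rowLen] at h5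
      change _ < lastPart S.outer at h5
      omega

theorem isTight_ordinaryReduction (hS : IsTight S) : IsTight (ordinaryReduction S) := by
  classical
  rw [ordinaryReduction_eq]
  split_ifs with h
  · exact hS.rotate h.2 h.1
  · exact hS

/-- When the shape is turned, the two bounds on distinct parts of complements sandwich the strict
inequality `np S.inner + 1 < np S.outer` and give the reverse relation for the new shape. -/
theorem isOrdinary_ordinaryReduction (hS : IsBasic S) : IsOrdinary (ordinaryReduction S) := by
  classical
  rw [ordinaryReduction_eq]
  split_ifs with h
  · refine ⟨hS.rotate, Or.inl ?_⟩
    have h1 := np_complement_le (firstPart S.outer) (len S.outer) S.inner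
    have h2 := np_le_np_complement S.outer
    change np (complement _ _ S.inner) ≤ np (complement _ _ S.outer) + 1
    omega
  · refine ⟨hS, ?_⟩
    by_cases h0 : S.inner = ⊥
    · exact Or.inr h0
    · exact Or.inl (not_lt.1 fun hlt => h ⟨hlt, h0⟩)

theorem IsSharp.ordinaryReduction (hS : IsSharp n S) : IsSharp n (ordinaryReduction S) := by
  classical
  rw [ordinaryReduction_eq]
  split_ifs
  · exact hS.rotate
  · exact hS

theorem multiplicityFree_ordinaryReduction :
    MultiplicityFree S n ↔ MultiplicityFree (ordinaryReduction S) n := by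
  classical
  rw [ordinaryReduction_eq]
  split_ifs
  · exact multiplicityFree_rotate.symm
  · rfl

end SkewSchur

/-! ### The demolition theorem -/

theorem theorem1p3 (n : ℕ) (S : SkewSchur.SkewPartition) :
    SkewSchur.demolitionTau n S ≤ n ∧
    SkewSchur.IsBasic (SkewSchur.demolition n S) ∧
    SkewSchur.IsSharp n (SkewSchur.demolition n S) ∧
    SkewSchur.IsSharp (n - SkewSchur.demolitionTau n S) (SkewSchur.demolition n S) ∧
    SkewSchur.IsTight (SkewSchur.demolition n S) ∧
    SkewSchur.IsOrdinary (SkewSchur.demolition n S) ∧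
    (SkewSchur.MultiplicityFree S n ↔
      SkewSchur.MultiplicityFree (SkewSchur.demolition n S)
        (n - SkewSchur.demolitionTau n S)) := by
  have hbasic := SkewSchur.isBasic_basicDemolition (SkewSchur.sharpDemolition n S)
  have hsharp := (SkewSchur.isSharp_sharpDemolition n S).basicDemolition
  have htight := SkewSchur.isTight_tightDemolition hbasic
  have hD := SkewSchur.isTight_ordinaryReduction htight
  have hDsharp : SkewSchur.IsSharp (n - SkewSchur.demolitionTau n S)
      (SkewSchur.demolition n S) :=
    -- Sharpness for the smaller number of variables is established right after trimming; deletion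
    -- and rotation do not enlarge columns.
    (hsharp.trimmed hbasic).basicDemolition.ordinaryReduction
  refine ⟨SkewSchur.tau_le hbasic hsharp, hD.1,
    fun k hk => (hDsharp k hk).trans_le (Nat.sub_le _ _), hDsharp, hD,
    SkewSchur.isOrdinary_ordinaryReduction htight.1, ?_⟩
  exact SkewSchur.multiplicityFree_sharpDemolition.trans
    (SkewSchur.multiplicityFree_basicDemolition.trans
      ((SkewSchur.multiplicityFree_trimmed hbasic hsharp).trans
        (SkewSchur.multiplicityFree_basicDemolition.trans
          SkewSchur.multiplicityFree_ordinaryReduction)))
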